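/- Let $S$ be a locally compact Hausdorff topological $*$-semigroup with identity, i.e. a locally compact Hausdorff monoid with jointly continuous multiplication and a continuous involution $x\mapsto x^*$ satisfying $(xy)^*=y^*x^*$ and $x^{**}=x$. Notation. $M(S)$ is the Banach space of bounded regular complex Borel measures on $S$ with the total variation norm. $L(S)$ is the set of $\mu\in M(S)$ such that $x\mapsto|\mu|*\delta_x$ and $x\mapsto\delta_x*|\mu|$ are continuous from $S$ into $M(S)$ with its weak topology $\sigma(M(S),M(S)^*)$. The semigroup $S$ is called foundation if $\bigcup_{\mu\in L(S)}\operatorname{supp}\mu$ is dense in $S$. $\Sigma(S)$ is the family of weakly continuous $*$-representations $\pi:S\to B(H_\pi)$ on Hilbert spaces with $\sup_{x\in S}\|\pi(x)\|\le 1$; for $\pi\in\Sigma(S)$ and $\mu\in M(S)$ the operator $\tilde\pi(\mu)$ is given by $\langle\tilde\pi(\mu)\xi,\eta\rangle=\int_S\langle\pi(x)\xi,\eta\rangle\,d\mu(x)$, and $\|\mu\|_\Sigma=\sup_{\pi\in\Sigma(S)}\|\tilde\pi(\mu)\|$. The full semigroup $C^*$-algebra $C^*(S)$ is the completion of $L(S)/\{\mu\in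 L(S):\|\mu\|_\Sigma=0\}$ in the norm induced by $\|\cdot\|_\Sigma$. A function $u:S\to\mathbb C$ is positive definite if $\sum_{i,j=1}^n\lambda_i\overline{\lambda_j}\,u(x_ix_j^*)\ge 0$ for all $n\ge 1$, $\lambda_1,\dots,\lambda_n\in\mathbb C$ and $x_1,\dots,x_n\in S$. The Fourier–Stieltjes algebra $B(S)$ is the linear span of the bounded continuous positive definite functions on $S$, with $$\|u\|=\sup\Big\{\Big|\int_S u\,d\mu\Big|:\mu\in L(S),\ \|\mu\|_\Sigma\le 1\Big\}\qquad(u\in B(S)).$$ Theorem. Suppose that $S$ is foundation and that $\Sigma(S)$ separates the points of $S$. Then the supremum above is finite for every $u\in B(S)$, and $B(S)$ with the norm $\|\cdot\|$ is isometrically isomorphic, as a Banach space, to the dual space $C^*(S)^*$. More precisely, there is a linear bijection $\Phi:B(S)\to C^*(S)^*$ with $\|\Phi(u)\|=\|u\|$ for all $u\in B(S)$ and $\Phi(u)(\mu)=\int_S u\,d\mu$ for all $u\in B(S)$ and $\mu\in L(S)$, where $\mu$ is identified with its image in $C^*(S)$. -/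

import Mathlib

open MeasureTheory Topology
open scoped ENNReal ComplexOrder ComplexConjugate InnerProductSpace

universe u

noncomputable section

namespace FoundationSemigroup

/-! ### The measure algebra `M(S)` -/

section Measures

variable {S : Type u} [TopologicalSpace S] [T2Space S] [MeasurableSpace S] [BorelSpace S]

/-- Every complex measure has finite total variation. -/
instance isFiniteMeasure_variation {X : Type*} [MeasurableSpace X] (μ : ComplexMeasure X) :
    IsFiniteMeasure μ.variation := by
  have h : μ.variation ≤ (ComplexMeasure.re μ).totalVariation
      + (ComplexMeasure.im μ).totalVariation := by
    refine VectorMeasure.variation_le_of_forall_enorm_le fun E _ => ?_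
    have h1 : ‖μ E‖ₑ ≤ ‖(μ E).re‖ₑ + ‖(μ E).im‖ₑ := by
      have h2 : ‖μ E‖₊ ≤ ‖(μ E).re‖₊ + ‖(μ E).im‖₊ := by
        exact_mod_cast Complex.norm_le_abs_re_add_abs_im (μ E)
      simp only [enorm_eq_nnnorm]
      exact_mod_cast h2
    refine h1.trans ?_
    rw [Measure.add_apply]
    exact add_le_add ((ComplexMeasure.re μ).enorm_le_totalVariation E)
      ((ComplexMeasure.im μ).enorm_le_totalVariation E)
  exact isFiniteMeasure_of_le _ h

/-- A finite Borel measure on a Hausdorff space which is approximated from within by compact sets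
is regular. -/
theorem regular_of_forall_exists_isCompact (μ : Measure S) [IsFiniteMeasure μ]
    (h : ∀ E, MeasurableSet E → ∀ ε : ℝ≥0∞, ε ≠ 0 → ∃ K ⊆ E, IsCompact K ∧ μ (E \ K) < ε) :
    μ.Regular := by
  have hin : μ.InnerRegular := by
    refine ⟨fun E hE r hr => ?_⟩
    obtain ⟨K, hKE, hK, hlt⟩ := h E hE (μ E - r) (tsub_pos_of_lt hr).ne'
    refine ⟨K, hKE, hK, ?_⟩
    by_contra hcon
    push Not at hcon
    have h1 : μ E ≤ μ K + μ (E \ K) := by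
      calc μ E ≤ μ (K ∪ E \ K) := measure_mono (by intro x hx; by_cases x ∈ K <;> simp_all)
        _ ≤ _ := measure_union_le _ _
    have h2 : μ E < r + (μ E - r) :=
      lt_of_le_of_lt (h1.trans (add_le_add_left hcon _))
        (ENNReal.add_lt_add_left (ne_top_of_lt hr) hlt)
    rw [add_tsub_cancel_of_le hr.le] at h2
    exact lt_irrefl _ h2
  have hout : μ.OuterRegular := by
    refine ⟨fun E hE r hr => ?_⟩
    obtain ⟨K, hKE, hK, hlt⟩ := h Eᶜ hE.compl (r - μ E) (tsub_pos_of_lt hr).ne'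
    refine ⟨Kᶜ, Set.subset_compl_comm.mp hKE, hK.isClosed.isOpen_compl, ?_⟩
    have h1 : μ Kᶜ ≤ μ E + μ (Eᶜ \ K) := by
      calc μ Kᶜ ≤ μ (E ∪ Eᶜ \ K) := measure_mono (by intro x hx; by_cases x ∈ E <;> simp_all)
        _ ≤ _ := measure_union_le _ _
    have h2 := lt_of_le_of_lt h1 (ENNReal.add_lt_add_left (measure_ne_top μ E) hlt)
    rwa [add_tsub_cancel_of_le hr.le] at h2
  exact { innerRegular := fun U hU r hr => hin.innerRegular hU.measurableSet r hr }

theorem exists_isCompact_diff_lt_of_regular (μ : Measure S) [IsFiniteMeasure μ] [μ.Regular]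
    {E : Set S} (hE : MeasurableSet E) {ε : ℝ≥0∞} (hε : ε ≠ 0) :
    ∃ K ⊆ E, IsCompact K ∧ μ (E \ K) < ε :=
  hE.exists_isCompact_sdiff_lt (measure_ne_top μ E) hε

theorem regular_of_le {μ ν : Measure S} [IsFiniteMeasure ν] [ν.Regular] (h : μ ≤ ν) :
    μ.Regular := by
  have : IsFiniteMeasure μ := isFiniteMeasure_of_le _ h
  refine regular_of_forall_exists_isCompact μ fun E hE ε hε => ?_
  obtain ⟨K, hKE, hK, hlt⟩ := exists_isCompact_diff_lt_of_regular ν hE hε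
  exact ⟨K, hKE, hK, lt_of_le_of_lt (h _) hlt⟩

theorem regular_add {μ ν : Measure S} [IsFiniteMeasure μ] [μ.Regular] [IsFiniteMeasure ν]
    [ν.Regular] : (μ + ν).Regular := by
  refine regular_of_forall_exists_isCompact _ fun E hE ε hε => ?_
  have hε' : ε / 2 ≠ 0 := by simpa using hε
  obtain ⟨K, hKE, hK, hK'⟩ := exists_isCompact_diff_lt_of_regular μ hE hε'
  obtain ⟨L, hLE, hL, hL'⟩ := exists_isCompact_diff_lt_of_regular ν hE hε'
  refine ⟨K ∪ L, Set.union_subset hKE hLE, hK.union hL, ?_⟩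
  rw [Measure.add_apply]
  calc μ (E \ (K ∪ L)) + ν (E \ (K ∪ L)) ≤ μ (E \ K) + ν (E \ L) := by
        gcongr <;> simp
    _ < ε / 2 + ε / 2 := ENNReal.add_lt_add hK' hL'
    _ = ε := ENNReal.add_halves ε

variable (S) in
/-- The complex Borel measures on `S` whose total variation is a regular measure. -/
def regularMeasures : Submodule ℂ (ComplexMeasure S) where
  carrier := {μ | μ.variation.Regular}
  zero_mem' := by
    show (VectorMeasure.variation (0 : ComplexMeasure S)).Regular
    rw [VectorMeasure.variation_zero]
    infer_instance
  add_mem' {μ ν} hμ hν := by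
    have : μ.variation.Regular := hμ
    have : ν.variation.Regular := hν
    have : (μ.variation + ν.variation).Regular := regular_add
    exact regular_of_le VectorMeasure.variation_add_le
  smul_mem' c μ hμ := by
    have : μ.variation.Regular := hμ
    show (VectorMeasure.variation (c • μ)).Regular
    rw [VectorMeasure.variation_smul]
    infer_instance

variable (S) in
/-- `M(S)`: the bounded regular complex Borel measures on `S`. -/
abbrev RegMeasure : Type u := ↥(regularMeasures S)

/-- The total variation norm `‖μ‖ = |μ|(S)`. -/
instance : Norm (RegMeasure S) := ⟨fun μ => (μ : ComplexMeasure S).variation.real Set.univ⟩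

theorem regMeasure_norm_def (μ : RegMeasure S) :
    ‖μ‖ = (μ : ComplexMeasure S).variation.real Set.univ := rfl

theorem regMeasure_normedSpaceCore : NormedSpace.Core ℂ (RegMeasure S) where
  norm_nonneg μ := measureReal_nonneg
  norm_smul c μ := by
    rw [regMeasure_norm_def, regMeasure_norm_def, Submodule.coe_smul,
      VectorMeasure.variation_smul]
    simp [measureReal_def]
  norm_triangle μ ν := by
    simp only [regMeasure_norm_def, Submodule.coe_add]
    rw [← measureReal_add_apply]
    exact ENNReal.toReal_mono (measure_ne_top _ _) (VectorMeasure.variation_add_le _)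
  norm_eq_zero_iff μ := by
    rw [regMeasure_norm_def, measureReal_eq_zero_iff, Measure.measure_univ_eq_zero,
      VectorMeasure.variation_eq_zero, Submodule.coe_eq_zero]

instance : NormedAddCommGroup (RegMeasure S) :=
  NormedAddCommGroup.ofCore regMeasure_normedSpaceCore

instance : NormedSpace ℂ (RegMeasure S) :=
  NormedSpace.ofCore regMeasure_normedSpaceCore

/-- The total variation `|μ|`, as an element of `M(S)`. -/
def absMeasure (μ : RegMeasure S) : RegMeasure S :=
  ⟨(μ : ComplexMeasure S).variation.toSignedMeasure.toComplexMeasure 0, by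
    have : (μ : ComplexMeasure S).variation.Regular := μ.2
    refine regular_of_le (ν := (μ : ComplexMeasure S).variation) ?_
    refine VectorMeasure.variation_le_of_forall_enorm_le fun E hE => ?_
    have h : (((μ : ComplexMeasure S).variation.toSignedMeasure.toComplexMeasure 0) E : ℂ)
        = (((μ : ComplexMeasure S).variation.real E : ℝ) : ℂ) := by
      rw [SignedMeasure.toComplexMeasure_apply]
      apply Complex.ext <;> simp [Measure.toSignedMeasure_apply_measurable hE]
    rw [h]
    rw [← ofReal_norm, Complex.norm_real, Real.norm_of_nonneg measureReal_nonneg,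
      ofReal_measureReal]⟩

/-- The push-forward of `μ ∈ M(S)` under a continuous map. -/
def pushforward (f : C(S, S)) (μ : RegMeasure S) : RegMeasure S :=
  ⟨(μ : ComplexMeasure S).map f, by
    have : (μ : ComplexMeasure S).variation.Regular := μ.2
    have : (Measure.map f (μ : ComplexMeasure S).variation).Regular := by
      refine regular_of_forall_exists_isCompact _ fun E hE ε hε => ?_
      obtain ⟨K, hKE, hK, hlt⟩ := exists_isCompact_diff_lt_of_regular
        (μ : ComplexMeasure S).variation (f.continuous.measurable hE) hε
      refine ⟨f '' K, by simpa using hKE, hK.image f.continuous, ?_⟩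
      rw [Measure.map_apply f.continuous.measurable
        (hE.diff (hK.image f.continuous).isClosed.measurableSet)]
      refine lt_of_le_of_lt (measure_mono ?_) hlt
      rintro x ⟨hx, hx'⟩
      exact ⟨hx, fun hxK => hx' ⟨x, hxK, rfl⟩⟩
    exact regular_of_le VectorMeasure.variation_map_le⟩

/-- The integral `∫ f dμ` of a complex function against a complex measure. -/
def integral (f : S → ℂ) (μ : RegMeasure S) : ℂ :=
  (μ : ComplexMeasure S).integral f (ContinuousLinearMap.mul ℝ ℂ)

theorem integrable_of_bounded {f : S → ℂ} (hf : Continuous f) {C : ℝ} (hC : ∀ x, ‖f x‖ ≤ C)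
    (μ : RegMeasure S) : (μ : ComplexMeasure S).Integrable f := by
  have : AEStronglyMeasurable f (μ : ComplexMeasure S).variation :=
    hf.measurable.aestronglyMeasurable
  exact Integrable.of_bound this C (Filter.Eventually.of_forall hC)

theorem integral_const_mul (c : ℂ) (f : S → ℂ) (μ : RegMeasure S) :
    integral (fun x => c * f x) μ = c * integral f μ := by
  unfold integral
  rw [VectorMeasure.integral_eq_setToFun, VectorMeasure.integral_eq_setToFun]
  exact setToFun_smul (𝕜 := ℂ) _ (fun c s x => by
    simp [transpose_eq_cbmApplyMeasure, mul_assoc]) c f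

theorem norm_integral_le {f : S → ℂ} {C : ℝ} (hC : ∀ x, ‖f x‖ ≤ C) (μ : RegMeasure S) :
    ‖integral f μ‖ ≤ C * ‖μ‖ := by
  have h := VectorMeasure.norm_integral_le_of_norm_le_const (μ := (μ : ComplexMeasure S))
    (B := ContinuousLinearMap.mul ℝ ℂ) (Filter.Eventually.of_forall hC)
  simpa [integral, regMeasure_norm_def] using h

end Measures

/-! ### The semigroup algebra `L(S)` -/

section SemigroupAlgebra

variable {S : Type u} [Monoid S] [TopologicalSpace S] [T2Space S] [ContinuousMul S]
  [MeasurableSpace S] [BorelSpace S]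

/-- `L_μ(x) = μ * δ_x`. The convolution of `μ` with a point mass at `x` is characterised by
`∫ f d(μ * δ_x) = ∫ f(yx) dμ(y)`, so it is the push-forward of `μ` under `y ↦ yx`. -/
def convDirac (μ : RegMeasure S) (x : S) : RegMeasure S :=
  pushforward (ContinuousMap.mk (fun y => y * x) (continuous_mul_const x)) μ

/-- `R_μ(x) = δ_x * μ`, the push-forward of `μ` under `y ↦ xy`. -/
def diracConv (x : S) (μ : RegMeasure S) : RegMeasure S :=
  pushforward (ContinuousMap.mk (fun y => x * y) (continuous_const_mul x)) μ

variable (S) in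
/-- The semigroup algebra `L(S)`: the measures `μ ∈ M(S)` for which `x ↦ |μ| * δ_x` and
`x ↦ δ_x * |μ|` are continuous from `S` to `M(S)` with its weak (Banach space) topology. -/
def semigroupAlgebra : Set (RegMeasure S) :=
  {μ | Continuous (fun x : S => toWeakSpace ℂ (RegMeasure S) (convDirac (absMeasure μ) x)) ∧
    Continuous (fun x : S => toWeakSpace ℂ (RegMeasure S) (diracConv x (absMeasure μ)))}

variable (S) in
/-- `S` is foundation: the supports of the measures in `L(S)` have dense union. -/
def IsFoundation : Prop :=
  Dense (⋃ μ ∈ semigroupAlgebra S, (μ : ComplexMeasure S).variation.support)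

end SemigroupAlgebra

/-! ### Representations -/

/-- `Σ(S)`: the weakly continuous `*`-representations `π` of `S` by operators on a Hilbert space
with `‖π‖ ≤ 1`. Hilbert spaces in the universe of `S` suffice: every such representation is a
direct sum of cyclic ones and of a zero one, and a cyclic one acts on a Hilbert space which is the
closed span of an image of `S`. -/
structure StarRep (S : Type u) [Monoid S] [StarMul S] [TopologicalSpace S] : Type (u + 1) where
  /-- the Hilbert space `H_π` -/
  H : Type u
  [instNACG : NormedAddCommGroup H]
  [instIPS : InnerProductSpace ℂ H]
  [instComplete : CompleteSpace H]
  /-- the semigroup homomorphism `π` -/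
  op : S →ₙ* (H →L[ℂ] H)
  map_star : ∀ x, op (star x) = ContinuousLinearMap.adjoint (op x)
  norm_le_one : ∀ x, ‖op x‖ ≤ 1
  continuous_coeff : ∀ ξ η : H, Continuous fun x => ⟪η, op x ξ⟫_ℂ

attribute [instance] StarRep.instNACG StarRep.instIPS StarRep.instComplete

section Representations

variable {S : Type u} [Monoid S] [StarMul S] [TopologicalSpace S]

variable (S) in
/-- `Σ(S)` separates the points of `S`. -/
def RepsSeparatePoints : Prop :=
  ∀ x y : S, x ≠ y → ∃ π : StarRep S, π.op x ≠ π.op y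

theorem StarRep.norm_coeff_le (π : StarRep S) (ξ η : π.H) (x : S) :
    ‖⟪η, π.op x ξ⟫_ℂ‖ ≤ ‖η‖ * ‖ξ‖ := by
  refine (norm_inner_le_norm _ _).trans ?_
  gcongr
  simpa using (π.op x).le_of_opNorm_le (π.norm_le_one x) ξ

variable [T2Space S] [MeasurableSpace S] [BorelSpace S]

/-- The bounded sesquilinear form `(η, ξ) ↦ ∫ ⟨π(x)ξ, η⟩ dμ(x)`. -/
def StarRep.form (π : StarRep S) (μ : RegMeasure S) : π.H →L⋆[ℂ] π.H →L[ℂ] ℂ :=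
  LinearMap.mkContinuous₂
    (LinearMap.mk₂'ₛₗ (starRingEnd ℂ) (RingHom.id ℂ)
      (fun η ξ => integral (fun x => ⟪η, π.op x ξ⟫_ℂ) μ)
      (fun η₁ η₂ ξ => by
        simp only [inner_add_left]
        exact VectorMeasure.integral_fun_add
          (integrable_of_bounded (π.continuous_coeff _ _) (π.norm_coeff_le _ _) μ)
          (integrable_of_bounded (π.continuous_coeff _ _) (π.norm_coeff_le _ _) μ))
      (fun c η ξ => by
        simp only [inner_smul_left]
        exact integral_const_mul _ _ μ)
      (fun η ξ₁ ξ₂ => by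
        simp only [map_add, inner_add_right]
        exact VectorMeasure.integral_fun_add
          (integrable_of_bounded (π.continuous_coeff _ _) (π.norm_coeff_le _ _) μ)
          (integrable_of_bounded (π.continuous_coeff _ _) (π.norm_coeff_le _ _) μ))
      (fun c η ξ => by
        simp only [map_smul, inner_smul_right]
        exact integral_const_mul _ _ μ))
    ‖μ‖
    (fun η ξ => by
      refine (norm_integral_le (π.norm_coeff_le ξ η) μ).trans (le_of_eq ?_)
      ring)

/-- The operator `π̃(μ) = ∫ π(x) dμ(x)`, see `StarRep.inner_intOp`. -/
def StarRep.intOp (π : StarRep S) (μ : RegMeasure S) : π.H →L[ℂ] π.H :=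
  ContinuousLinearMap.adjoint (InnerProductSpace.continuousLinearMapOfBilin (π.form μ))

/-- The defining property `⟨π̃(μ)ξ, η⟩ = ∫ ⟨π(x)ξ, η⟩ dμ(x)` (the inner product of Mathlib is
linear in its second argument). -/
theorem StarRep.inner_intOp (π : StarRep S) (μ : RegMeasure S) (ξ η : π.H) :
    ⟪η, π.intOp μ ξ⟫_ℂ = integral (fun x => ⟪η, π.op x ξ⟫_ℂ) μ := by
  rw [StarRep.intOp, ContinuousLinearMap.adjoint_inner_right,
    InnerProductSpace.continuousLinearMapOfBilin_apply]
  rfl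

theorem StarRep.norm_intOp_le (π : StarRep S) (μ : RegMeasure S) : ‖π.intOp μ‖ ≤ ‖μ‖ := by
  refine ContinuousLinearMap.opNorm_le_bound _ (norm_nonneg μ) fun ξ => ?_
  rcases eq_or_ne (π.intOp μ ξ) 0 with h0 | h0
  · rw [h0, norm_zero]; positivity
  have h : ‖π.intOp μ ξ‖ * ‖π.intOp μ ξ‖ ≤ (‖μ‖ * ‖ξ‖) * ‖π.intOp μ ξ‖ := by
    have h1 : ‖⟪π.intOp μ ξ, π.intOp μ ξ⟫_ℂ‖ ≤ (‖π.intOp μ ξ‖ * ‖ξ‖) * ‖μ‖ := by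
      rw [StarRep.inner_intOp]
      exact norm_integral_le (π.norm_coeff_le ξ _) μ
    rw [inner_self_eq_norm_sq_to_K] at h1
    simp only [norm_pow, RCLike.norm_ofReal, abs_norm] at h1
    linarith
  exact le_of_mul_le_mul_right h (norm_pos_iff.mpr h0)

/-- `‖μ‖_Σ = sup {‖π̃(μ)‖ : π ∈ Σ(S)}`. -/
def sigmaNorm (μ : RegMeasure S) : ℝ := ⨆ π : StarRep S, ‖π.intOp μ‖

variable (S) in
/-- The `ℓ^∞`-product of the C*-algebras `B(H_π)`, `π ∈ Σ(S)`. -/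
abbrev RepProduct : Type (u + 1) := lp (fun π : StarRep S => π.H →L[ℂ] π.H) ∞

instance : NonUnitalNormedRing (RepProduct S) := lp.nonUnitalNormedRing

instance : StarRing (RepProduct S) := lp.inftyStarRing

instance : CStarRing (RepProduct S) := lp.inftyCStarRing

instance : NonUnitalCStarAlgebra (RepProduct S) where

instance : NonUnitalRing (RepProduct S) := NonUnitalNormedRing.toNonUnitalRing

instance : NonUnitalSemiring (RepProduct S) := NonUnitalRing.toNonUnitalSemiring

instance : NonUnitalNonAssocSemiring (RepProduct S) :=
  NonUnitalSemiring.toNonUnitalNonAssocSemiring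

/-- The family `(π̃(μ))_{π ∈ Σ(S)}`, in the `ℓ^∞`-product of the algebras `B(H_π)`. -/
def sigmaRep (μ : RegMeasure S) : RepProduct S :=
  ⟨fun π => π.intOp μ, memℓp_infty ⟨‖μ‖, by
    rintro _ ⟨π, rfl⟩
    exact π.norm_intOp_le μ⟩⟩

theorem norm_sigmaRep (μ : RegMeasure S) : ‖sigmaRep μ‖ = sigmaNorm μ :=
  lp.norm_eq_ciSup _

end Representations

/-! ### The semigroup C*-algebra -/

section CStar

variable {S : Type u} [Monoid S] [StarMul S] [TopologicalSpace S] [T2Space S] [ContinuousMul S]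
  [MeasurableSpace S] [BorelSpace S]

variable (S) in
/-- The full semigroup C*-algebra `C*(S)`, the completion of `L(S)/I_Σ` in the norm induced by
`‖·‖_Σ`. It is realised in the `ℓ^∞`-product of the C*-algebras `B(H_π)`, `π ∈ Σ(S)`, where the
image of `μ` has norm `‖μ‖_Σ` and vanishes exactly when `μ ∈ I_Σ`: there it is the norm closure of
the `*`-algebra formed by the images of the elements of `L(S)`. -/
def cstarSubalgebra : NonUnitalStarSubalgebra ℂ (RepProduct S) :=
  (NonUnitalStarAlgebra.adjoin ℂ (sigmaRep '' semigroupAlgebra S)).topologicalClosure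

variable (S) in
/-- The full semigroup C*-algebra `C*(S)`, as a type. -/
def SemigroupCStar : Type (u + 1) := ↥(cstarSubalgebra S)

instance : NonUnitalCStarAlgebra (SemigroupCStar S) :=
  @NonUnitalStarSubalgebra.nonUnitalCStarAlgebra _ _ _ _ _ _ _ (cstarSubalgebra S)
    (NonUnitalStarSubalgebra.isClosed_topologicalClosure _)

/-- The canonical map `L(S) → C*(S)`. -/
def toCStar (μ : semigroupAlgebra S) : SemigroupCStar S :=
  ⟨sigmaRep (μ : RegMeasure S), NonUnitalStarSubalgebra.le_topologicalClosure _
    (NonUnitalStarAlgebra.subset_adjoin ℂ _ ⟨μ, μ.2, rfl⟩)⟩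

theorem norm_toCStar (μ : semigroupAlgebra S) :
    ‖toCStar μ‖ = sigmaNorm (μ : RegMeasure S) :=
  norm_sigmaRep _

end CStar

/-! ### The Fourier–Stieltjes algebra -/

/-- Positive definite functions on a `*`-semigroup. -/
def IsPosDef {S : Type u} [Monoid S] [StarMul S] (u : S → ℂ) : Prop :=
  ∀ (n : ℕ) (c : Fin n → ℂ) (x : Fin n → S),
    0 ≤ ∑ i, ∑ j, c i * conj (c j) * u (x i * star (x j))

/-- `P(S)`: the bounded continuous positive definite functions on `S`. -/
def posDefFunctions (S : Type u) [Monoid S] [StarMul S] [TopologicalSpace S] : Set (S → ℂ) :=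
  {u | Continuous u ∧ (∃ C : ℝ, ∀ x, ‖u x‖ ≤ C) ∧ IsPosDef u}

/-- The Fourier–Stieltjes algebra `B(S)`, as a vector space: the linear span of `P(S)`. -/
def fourierStieltjes (S : Type u) [Monoid S] [StarMul S] [TopologicalSpace S] :
    Submodule ℂ (S → ℂ) :=
  Submodule.span ℂ (posDefFunctions S)

section Norm

variable {S : Type u} [Monoid S] [StarMul S] [TopologicalSpace S] [T2Space S] [ContinuousMul S]
  [MeasurableSpace S] [BorelSpace S]

/-- The numbers `|∫ u dμ|` with `μ ∈ L(S)` and `‖μ‖_Σ ≤ 1`. -/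
def pairingValues (u : S → ℂ) : Set ℝ :=
  {r | ∃ μ ∈ semigroupAlgebra S, sigmaNorm μ ≤ 1 ∧ r = ‖integral u μ‖}

/-- The norm of `B(S)`: `‖u‖ = sup {|∫ u dμ| : μ ∈ L(S), ‖μ‖_Σ ≤ 1}`. -/
def fsNorm (u : S → ℂ) : ℝ := sSup (pairingValues u)

end Norm

end FoundationSemigroup

end

/-!
A measure belongs to `L(S)` exactly when the translates of its total variation are setwise
continuous. A setwise continuous family on a compact space is dominated by a single measure `q`, so
on it every functional of `M(S)` is integration of a bounded density, by the duality of `L¹(q)` and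
`L^∞(q)`. Functionals therefore commute with the average `∫ δ_x * q dp(x)` that defines `p * q`,
which makes `L(S)` a `*`-algebra, of which `C*(S)` is the closed image.

A positive definite function is a coefficient of a representation in `Σ(S)`, so it acts boundedly on
`C*(S)`. Conversely, the quasi-states of `C*(S)` span its dual, by Hahn–Banach separation. The GNS
construction, applied to a quasi-state `φ` and to the left translations by `S` on `C*(S)`, yields a
representation of `S` and a vector whose coefficient is positive definite and represents `φ`. On a
foundation semigroup the representing function is unique, because it is determined on the supports
of the measures in `L(S)`.
-/

noncomputable section

namespace FoundationSemigroup

/-! ### Bounded measurable functions -/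

section BoundedMeasurable

variable {X Y : Type*} [MeasurableSpace X] [MeasurableSpace Y]

/-- The bounded measurable functions, which are those with an integral against every measure of
`M(S)`. -/
structure BoundedMeasurable (f : X → ℂ) : Prop where
  measurable : Measurable f
  bounded : ∃ C : ℝ, ∀ x, ‖f x‖ ≤ C

namespace BoundedMeasurable

theorem add {f g : X → ℂ} (hf : BoundedMeasurable f) (hg : BoundedMeasurable g) :
    BoundedMeasurable (f + g) := by
  obtain ⟨C, hC⟩ := hf.bounded
  obtain ⟨D, hD⟩ := hg.bounded
  exact ⟨hf.measurable.add hg.measurable, C + D, fun x => norm_add_le_of_le (hC x) (hD x)⟩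

theorem indicator_const (c : ℂ) {E : Set X} (hE : MeasurableSet E) :
    BoundedMeasurable (E.indicator fun _ => c) :=
  ⟨measurable_const.indicator hE, ‖c‖, fun x => norm_indicator_le_norm_self (fun _ => c) x⟩

theorem simpleFunc (s : SimpleFunc X ℂ) : BoundedMeasurable s :=
  ⟨s.measurable, s.exists_forall_norm_le⟩

theorem comp {f : X → ℂ} (hf : BoundedMeasurable f) {T : Y → X} (hT : Measurable T) :
    BoundedMeasurable fun y => f (T y) :=
  ⟨hf.measurable.comp hT, hf.bounded.imp fun _ hC y => hC (T y)⟩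

theorem integrable {f : X → ℂ} (hf : BoundedMeasurable f) (p : Measure X) [IsFiniteMeasure p] :
    Integrable f p := by
  obtain ⟨C, hC⟩ := hf.bounded
  exact Integrable.of_bound hf.measurable.aestronglyMeasurable C (Filter.Eventually.of_forall hC)

theorem exists_simpleFunc_norm_sub_le {f : X → ℂ} (hf : BoundedMeasurable f) {ε : ℝ}
    (hε : 0 < ε) : ∃ s : SimpleFunc X ℂ, ∀ x, ‖f x - s x‖ ≤ ε := by
  obtain ⟨C, hC⟩ := hf.bounded
  let e := TopologicalSpace.denseSeq ℂ
  obtain ⟨t, ht⟩ := (isCompact_closedBall (0 : ℂ) C).elim_finite_subcover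
    (fun k => Metric.ball (e k) ε) (fun _ => Metric.isOpen_ball) fun z _ => by
      obtain ⟨k, hk⟩ := (TopologicalSpace.denseRange_denseSeq ℂ).exists_dist_lt z hε
      exact Set.mem_iUnion.2 ⟨k, hk⟩
  obtain ⟨N, hN⟩ := t.exists_nat_subset_range
  refine ⟨(SimpleFunc.nearestPt e N).comp f hf.measurable, fun x => ?_⟩
  obtain ⟨k, hk, hx⟩ := Set.mem_iUnion₂.1 (ht (mem_closedBall_zero_iff.2 (hC x)))
  have hnear := SimpleFunc.edist_nearestPt_le e (f x) (Finset.mem_range.1 (hN hk)).le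
  rw [edist_dist, edist_dist, ENNReal.ofReal_le_ofReal_iff dist_nonneg] at hnear
  calc ‖f x - SimpleFunc.nearestPt e N (f x)‖ = dist (SimpleFunc.nearestPt e N (f x)) (f x) := by
        rw [dist_comm, dist_eq_norm]
    _ ≤ dist (e k) (f x) := hnear
    _ ≤ ε := by rw [dist_comm]; exact (Metric.mem_ball.1 hx).le

theorem exists_tendstoUniformly {f : X → ℂ} (hf : BoundedMeasurable f) :
    ∃ s : ℕ → SimpleFunc X ℂ, TendstoUniformly (fun n x => s n x) f Filter.atTop := by
  choose s hs using fun n : ℕ =>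
    hf.exists_simpleFunc_norm_sub_le (Nat.one_div_pos_of_nat (n := n) (α := ℝ))
  refine ⟨s, Metric.tendstoUniformly_iff.2 fun ε hε => ?_⟩
  filter_upwards [tendsto_one_div_add_atTop_nhds_zero_nat.eventually (gt_mem_nhds hε)]
    with n hn x
  rw [dist_eq_norm]
  exact (hs n x).trans_lt hn

@[elab_as_elim]
theorem induction {P : ∀ f : X → ℂ, BoundedMeasurable f → Prop}
    (indicator : ∀ (c : ℂ) (E : Set X) (hE : MeasurableSet E), P _ (.indicator_const c hE))
    (add : ∀ f g (hf : BoundedMeasurable f) (hg : BoundedMeasurable g),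
      P f hf → P g hg → P (f + g) (hf.add hg))
    (lim : ∀ (g : ℕ → X → ℂ) (f : X → ℂ) (hg : ∀ n, BoundedMeasurable (g n))
      (hf : BoundedMeasurable f), TendstoUniformly g f Filter.atTop → (∀ n, P (g n) (hg n)) →
      P f hf)
    {f : X → ℂ} (hf : BoundedMeasurable f) : P f hf := by
  have hsimple : ∀ s : SimpleFunc X ℂ, P s (.simpleFunc s) := by
    intro s
    induction s using SimpleFunc.induction with
    | const c hE =>
      convert indicator c _ hE using 1
      exact SimpleFunc.coe_piecewise _ _ _
    | add _ hf hg => exact add _ _ (.simpleFunc _) (.simpleFunc _) hf hg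
  obtain ⟨s, hs⟩ := hf.exists_tendstoUniformly
  exact lim _ f (fun n => .simpleFunc (s n)) hf hs fun n => hsimple (s n)

end BoundedMeasurable

theorem tendstoUniformly_integral {ι : Type*} {g : ℕ → X → ℂ} {f : X → ℂ}
    (hg : ∀ n, BoundedMeasurable (g n)) (hf : BoundedMeasurable f)
    (hlim : TendstoUniformly g f Filter.atTop) (p : ι → Measure X) [∀ i, IsFiniteMeasure (p i)]
    {C : ℝ} (hC : ∀ i, (p i).real Set.univ ≤ C) :
    TendstoUniformly (fun n i => ∫ x, g n x ∂p i) (fun i => ∫ x, f x ∂p i) Filter.atTop := by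
  refine Metric.tendstoUniformly_iff.2 fun ε hε => ?_
  have hD : 0 < |C| + 1 := by positivity
  filter_upwards [Metric.tendstoUniformly_iff.1 hlim (ε / (|C| + 1)) (by positivity)] with n hn i
  rw [dist_eq_norm, ← MeasureTheory.integral_sub (hf.integrable _) ((hg n).integrable _)]
  have hle : ∀ x, ‖f x - g n x‖ ≤ ε / (|C| + 1) := fun x => by
    rw [← dist_eq_norm]; exact (hn x).le
  calc ‖∫ x, f x - g n x ∂p i‖ ≤ ε / (|C| + 1) * (p i).real Set.univ :=
        norm_integral_le_of_norm_le_const (Filter.Eventually.of_forall hle)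
    _ ≤ ε / (|C| + 1) * |C| := by gcongr; exact (hC i).trans (le_abs_self C)
    _ < ε / (|C| + 1) * (|C| + 1) := by gcongr; linarith
    _ = ε := div_mul_cancel₀ ε hD.ne'

end BoundedMeasurable

/-! ### Regular measures -/

section Regular

variable {S : Type u} [TopologicalSpace S] [T2Space S] [MeasurableSpace S] [BorelSpace S]

theorem regular_of_absolutelyContinuous_sum {ι : Type*} [Countable ι] (m : ι → Measure S)
    [∀ i, IsFiniteMeasure (m i)] [∀ i, (m i).Regular] {p : Measure S} [IsFiniteMeasure p]
    (hp : p ≪ Measure.sum m) : p.Regular := by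
  refine regular_of_forall_exists_isCompact p fun E hE ε hε => ?_
  choose K hKE hK hKm using fun k : ι × ℕ => exists_isCompact_diff_lt_of_regular (m k.1) hE
    (ENNReal.inv_ne_zero.2 (ENNReal.natCast_ne_top k.2))
  have hKmeas : ∀ k, MeasurableSet (K k) := fun k => (hK k).measurableSet
  let R : Finset (ι × ℕ) → Set S := fun t => E \ ⋃ k ∈ t, K k
  have hRmeas : ∀ t, MeasurableSet (R t) := fun t =>
    hE.diff (t.measurableSet_biUnion fun k _ => hKmeas k)
  have hnull : p (⋂ t, R t) = 0 := by
    refine hp ((Measure.sum_apply_eq_zero' (MeasurableSet.iInter hRmeas)).2 fun i => ?_)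
    have hle : ∀ n : ℕ, m i (⋂ t, R t) ≤ (n : ℝ≥0∞)⁻¹ := fun n =>
      (measure_mono ((Set.iInter_subset R {(i, n)}).trans (by simp [R]))).trans (hKm (i, n)).le
    exact le_antisymm (ge_of_tendsto' ENNReal.tendsto_inv_nat_nhds_zero hle) bot_le
  have htend : Filter.Tendsto (fun t => p (R t)) Filter.atTop (𝓝 0) := by
    rw [← hnull]
    exact tendsto_measure_iInter_atTop (fun t => (hRmeas t).nullMeasurableSet)
      (fun t t' h => Set.sdiff_subset_sdiff_right (Set.biUnion_subset_biUnion_left h))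
      ⟨∅, measure_ne_top p _⟩
  obtain ⟨t, ht⟩ := (htend.eventually (gt_mem_nhds (pos_iff_ne_zero.2 hε))).exists
  exact ⟨⋃ k ∈ t, K k, Set.iUnion₂_subset fun k _ => hKE k, t.isCompact_biUnion fun k _ => hK k, ht⟩

theorem regular_of_absolutelyContinuous {p q : Measure S} [IsFiniteMeasure q] [q.Regular]
    [IsFiniteMeasure p] (h : p ≪ q) : p.Regular :=
  regular_of_absolutelyContinuous_sum (fun _ : Unit => q)
    (h.trans (Measure.le_sum _ ()).absolutelyContinuous)

instance (μ : RegMeasure S) : (μ : ComplexMeasure S).variation.Regular := μ.2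

instance (p : Measure S) [IsFiniteMeasure p] [p.Regular] (E : Set S) : (p.restrict E).Regular :=
  regular_of_absolutelyContinuous Measure.restrict_le_self.absolutelyContinuous

instance (p q : Measure S) [IsFiniteMeasure p] [p.Regular] [IsFiniteMeasure q] [q.Regular] :
    (p + q).Regular :=
  regular_add

theorem regular_map (p : Measure S) [IsFiniteMeasure p] [p.Regular] {f : S → S}
    (hf : Continuous f) : (p.map f).Regular := by
  refine regular_of_forall_exists_isCompact _ fun E hE ε hε => ?_
  obtain ⟨K, hKE, hK, hlt⟩ := exists_isCompact_diff_lt_of_regular p (hf.measurable hE) hε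
  refine ⟨f '' K, Set.image_subset_iff.2 hKE, hK.image hf, ?_⟩
  rw [Measure.map_apply hf.measurable (hE.diff (hK.image hf).measurableSet)]
  exact (measure_mono (Set.sdiff_subset_sdiff_right (Set.subset_preimage_image f K))).trans_lt hlt

end Regular

/-! ### Integration against the measures in `M(S)` -/

section Integral

variable {S : Type u} [TopologicalSpace S] [T2Space S] [MeasurableSpace S] [BorelSpace S]

theorem regMeasure_ext {μ ν : RegMeasure S}
    (h : ∀ E, MeasurableSet E → (μ : ComplexMeasure S) E = (ν : ComplexMeasure S) E) : μ = ν :=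
  Subtype.ext (VectorMeasure.ext h)

theorem integral_indicator (c : ℂ) {E : Set S} (hE : MeasurableSet E) (μ : RegMeasure S) :
    integral (E.indicator fun _ => c) μ = c * (μ : ComplexMeasure S) E := by
  rw [integral, VectorMeasure.integral_eq_setToFun,
    setToFun_indicator_const _ hE (measure_ne_top _ _)]
  simp [transpose_eq_cbmApplyMeasure]

theorem integral_add {f g : S → ℂ} (hf : BoundedMeasurable f) (hg : BoundedMeasurable g)
    (μ : RegMeasure S) : integral (f + g) μ = integral f μ + integral g μ :=
  VectorMeasure.integral_add (hf.integrable _) (hg.integrable _)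

theorem tendsto_integral {g : ℕ → S → ℂ} {f : S → ℂ} (hg : ∀ n, BoundedMeasurable (g n))
    (hf : BoundedMeasurable f) (hlim : TendstoUniformly g f Filter.atTop) (μ : RegMeasure S) :
    Filter.Tendsto (fun n => integral (g n) μ) Filter.atTop (𝓝 (integral f μ)) := by
  obtain ⟨C, hC⟩ := hf.bounded
  refine VectorMeasure.tendsto_integral_filter_of_norm_le_const
    (.of_forall fun n => (hg n).measurable.aestronglyMeasurable) ⟨C + 1, ?_⟩
    (.of_forall fun x => hlim.tendsto_at x)
  filter_upwards [Metric.tendstoUniformly_iff.1 hlim 1 one_pos] with n hn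
  refine .of_forall fun x => ?_
  rw [← sub_add_cancel (g n x) (f x), add_comm]
  exact norm_add_le_of_le (hC x) (by rw [← dist_eq_norm, dist_comm]; exact (hn x).le)

theorem integral_add_measure {f : S → ℂ} (hf : BoundedMeasurable f) (μ ν : RegMeasure S) :
    integral f (μ + ν) = integral f μ + integral f ν :=
  VectorMeasure.integral_add_vectorMeasure (hf.integrable _) (hf.integrable _)

theorem integral_smul_measure {f : S → ℂ} (hf : BoundedMeasurable f) (c : ℂ) (μ : RegMeasure S) :
    integral f (c • μ) = c * integral f μ := by
  induction hf using BoundedMeasurable.induction with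
  | indicator d E hE =>
    rw [integral_indicator _ hE, integral_indicator _ hE]
    simp only [Submodule.coe_smul, FunLike.coe_smul, Pi.smul_apply, smul_eq_mul]
    ring
  | add f g hf hg hPf hPg => rw [integral_add hf hg, integral_add hf hg, hPf, hPg, mul_add]
  | lim g f hg hf hlim hP =>
    refine tendsto_nhds_unique (tendsto_integral hg hf hlim (c • μ)) ?_
    simp only [hP]
    exact (tendsto_integral hg hf hlim μ).const_mul c

/-- Integration of a bounded measurable function, as a bounded functional on `M(S)`. -/
def integralCLM {f : S → ℂ} (hf : BoundedMeasurable f) : StrongDual ℂ (RegMeasure S) :=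
  LinearMap.mkContinuous
    { toFun := integral f
      map_add' := integral_add_measure hf
      map_smul' := integral_smul_measure hf } hf.bounded.choose
    (norm_integral_le hf.bounded.choose_spec)

theorem integralCLM_apply {f : S → ℂ} (hf : BoundedMeasurable f) (μ : RegMeasure S) :
    integralCLM hf μ = integral f μ := rfl

/-- A finite regular positive measure as an element of `M(S)`. -/
def ofMeasure (p : Measure S) [IsFiniteMeasure p] [p.Regular] : RegMeasure S :=
  ⟨p.withDensityᵥ fun _ => (1 : ℂ), by
    change ((p.withDensityᵥ fun _ => (1 : ℂ)).variation).Regular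
    rw [Measure.variation_withDensityᵥ (integrable_const _)]
    simpa⟩

theorem ofMeasure_apply (p : Measure S) [IsFiniteMeasure p] [p.Regular] {E : Set S}
    (hE : MeasurableSet E) : (ofMeasure p : ComplexMeasure S) E = p.real E := by
  rw [ofMeasure, withDensityᵥ_apply (integrable_const _) hE]
  simp [measureReal_def]

theorem variation_ofMeasure (p : Measure S) [IsFiniteMeasure p] [p.Regular] :
    (ofMeasure p : ComplexMeasure S).variation = p := by
  simp [ofMeasure, Measure.variation_withDensityᵥ (integrable_const _)]

theorem absMeasure_eq_ofMeasure (μ : RegMeasure S) :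
    absMeasure μ = ofMeasure (μ : ComplexMeasure S).variation := by
  refine regMeasure_ext fun E hE => ?_
  rw [ofMeasure_apply _ hE, absMeasure, SignedMeasure.toComplexMeasure_apply]
  apply Complex.ext <;> simp [Measure.toSignedMeasure_apply_measurable hE]

theorem integral_ofMeasure {f : S → ℂ} (hf : BoundedMeasurable f) (p : Measure S)
    [IsFiniteMeasure p] [p.Regular] : integral f (ofMeasure p) = ∫ x, f x ∂p := by
  induction hf using BoundedMeasurable.induction with
  | indicator c E hE =>
    rw [integral_indicator _ hE, ofMeasure_apply _ hE, MeasureTheory.integral_indicator_const _ hE,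
      Complex.real_smul, mul_comm]
  | add f g hf hg hPf hPg =>
    rw [integral_add hf hg, hPf, hPg]
    exact (MeasureTheory.integral_add (hf.integrable p) (hg.integrable p)).symm
  | lim g f hg hf hlim hP =>
    refine tendsto_nhds_unique (tendsto_integral hg hf hlim _) ?_
    simp only [hP]
    exact (tendstoUniformly_integral hg hf hlim (fun _ : Unit => p) fun _ => le_rfl).tendsto_at ()

theorem pushforward_apply (f : C(S, S)) (μ : RegMeasure S) {E : Set S} (hE : MeasurableSet E) :
    (pushforward f μ : ComplexMeasure S) E = (μ : ComplexMeasure S) (f ⁻¹' E) :=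
  VectorMeasure.map_apply _ f.continuous.measurable hE

theorem integral_pushforward (T : C(S, S)) {f : S → ℂ} (hf : BoundedMeasurable f)
    (μ : RegMeasure S) : integral f (pushforward T μ) = integral (fun x => f (T x)) μ :=
  VectorMeasure.integral_map T.continuous.measurable hf.measurable.aestronglyMeasurable
    ((hf.comp T.continuous.measurable).integrable _)

end Integral

section Decomposition

variable {S : Type u} [TopologicalSpace S] [T2Space S] [MeasurableSpace S] [BorelSpace S]

variable (S) in
/-- The cone of positive measures in `M(S)`, cut down by a predicate on measures. -/
def positiveMeasures (P : Measure S → Prop) : Set (RegMeasure S) :=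
  {μ | ∃ (p : Measure S) (_ : IsFiniteMeasure p) (_ : p.Regular), P p ∧ ofMeasure p = μ}

theorem jordan_le_variation {X : Type*} [MeasurableSpace X] {s : SignedMeasure X}
    {m : ComplexMeasure X} (h : ∀ E, ‖s E‖ₑ ≤ ‖m E‖ₑ) :
    s.toJordanDecomposition.posPart ≤ m.variation ∧
      s.toJordanDecomposition.negPart ≤ m.variation := by
  have htotal : s.totalVariation ≤ m.variation := by
    rw [SignedMeasure.totalVariation_eq_variation]
    exact VectorMeasure.variation_le_of_forall_enorm_le fun E _ =>
      (h E).trans (VectorMeasure.enorm_measure_le_variation _ _)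
  exact ⟨(Measure.le_add_right le_rfl).trans htotal, (Measure.le_add_left le_rfl).trans htotal⟩

theorem exists_ofMeasure_sub_eq (μ : RegMeasure S) {s : SignedMeasure S}
    (h : ∀ E, ‖s E‖ₑ ≤ ‖(μ : ComplexMeasure S) E‖ₑ) :
    ∃ ν ∈ Submodule.span ℂ (positiveMeasures S (· ≤ (μ : ComplexMeasure S).variation)),
      ∀ E, MeasurableSet E → (ν : ComplexMeasure S) E = (s E : ℝ) := by
  obtain ⟨hpos, hneg⟩ := jordan_le_variation h
  have := regular_of_le hpos
  have := regular_of_le hneg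
  refine ⟨ofMeasure s.toJordanDecomposition.posPart - ofMeasure s.toJordanDecomposition.negPart,
    Submodule.sub_mem _ (Submodule.subset_span ⟨_, inferInstance, inferInstance, hpos, rfl⟩)
      (Submodule.subset_span ⟨_, inferInstance, inferInstance, hneg, rfl⟩), fun E hE => ?_⟩
  conv_rhs => rw [← s.toSignedMeasure_toJordanDecomposition]
  simp [JordanDecomposition.toSignedMeasure, Measure.toSignedMeasure_apply_measurable hE,
    ofMeasure_apply _ hE]

theorem mem_span_positiveMeasures (μ : RegMeasure S) :
    μ ∈ Submodule.span ℂ (positiveMeasures S (· ≤ (μ : ComplexMeasure S).variation)) := by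
  obtain ⟨ν, hν, hνE⟩ := exists_ofMeasure_sub_eq μ (s := ComplexMeasure.re μ) fun E =>
    enorm_le_iff_norm_le.2 (Complex.abs_re_le_norm _)
  obtain ⟨ρ, hρ, hρE⟩ := exists_ofMeasure_sub_eq μ (s := ComplexMeasure.im μ) fun E =>
    enorm_le_iff_norm_le.2 (Complex.abs_im_le_norm _)
  have hmem := Submodule.add_mem _ hν (Submodule.smul_mem _ Complex.I hρ)
  have h : ν + Complex.I • ρ = μ := regMeasure_ext fun E hE => by
    simp only [Submodule.coe_add, Submodule.coe_smul, FunLike.coe_add, FunLike.coe_smul,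
      Pi.add_apply, Pi.smul_apply, hνE E hE, hρE E hE, smul_eq_mul]
    rw [mul_comm]
    exact Complex.re_add_im _
  rwa [h] at hmem

end Decomposition

section Density

theorem exists_boundedMeasurable_ae_eq {X : Type*} [MeasurableSpace X] {q : Measure X}
    {k : X → ℂ} (hk : AEMeasurable k q) {C : ℝ}
    (hC : 0 ≤ C) (hbound : ∀ᵐ x ∂q, ‖k x‖ ≤ C) :
    ∃ g : X → ℂ, BoundedMeasurable g ∧ g =ᵐ[q] k := by
  let A : Set X := {x | ‖hk.mk k x‖ ≤ C}
  have hA : MeasurableSet A := measurableSet_le hk.measurable_mk.norm measurable_const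
  refine ⟨A.indicator (hk.mk k), ⟨hk.measurable_mk.indicator hA, C, fun x => ?_⟩, ?_⟩
  · by_cases hx : x ∈ A
    · rw [Set.indicator_of_mem hx]
      exact hx
    · rwa [Set.indicator_of_notMem hx, norm_zero]
  · filter_upwards [hbound, hk.ae_eq_mk] with x hx hxk
    rw [hxk] at hx ⊢
    exact Set.indicator_of_mem (s := A) hx _

variable {X : Type*} [MeasurableSpace X] (q : Measure X) [IsFiniteMeasure q]

theorem ae_norm_le_of_forall_norm_setIntegral_le {g : X → ℂ} (hg : Integrable g q)
    {C : ℝ} (hC : 0 ≤ C) (h : ∀ E, MeasurableSet E → ‖∫ x in E, g x ∂q‖ ≤ C * q.real E) :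
    ∀ᵐ x ∂q, ‖g x‖ ≤ C := by
  have hvar : q.withDensity (‖g ·‖ₑ) ≤ ENNReal.ofReal C • q := by
    rw [← Measure.variation_withDensityᵥ hg]
    refine VectorMeasure.variation_le_of_forall_enorm_le fun E hE => ?_
    rw [withDensityᵥ_apply hg hE, ← ofReal_norm, Measure.smul_apply, smul_eq_mul,
      ← ofReal_measureReal, ← ENNReal.ofReal_mul' measureReal_nonneg]
    exact ENNReal.ofReal_le_ofReal (h E hE)
  have hae : (‖g ·‖ₑ) ≤ᵐ[q] fun _ => ENNReal.ofReal C :=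
    ae_le_of_forall_setLIntegral_le_of_sigmaFinite₀ hg.1.enorm fun E hE _ => by
      rw [← withDensity_apply _ hE, setLIntegral_const]
      exact hvar E
  filter_upwards [hae] with x hx
  exact (ENNReal.ofReal_le_ofReal_iff hC).1 (by rwa [ofReal_norm])

theorem exists_setIntegral_eq_of_dual_L1 (L : StrongDual ℂ (Lp ℂ 1 q)) :
    ∃ g : X → ℂ, Integrable g q ∧ ∀ (E : Set X) (hE : MeasurableSet E),
      L (indicatorConstLp 1 hE (measure_ne_top q E) 1) = ∫ x in E, g x ∂q := by
  let one : Lp ℂ 2 q := Lp.const 2 q 1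
  let incl : Lp ℂ 2 q →L[ℂ] Lp ℂ 1 q :=
    (ContinuousLinearMap.mul ℂ ℂ).holderL q 2 2 1 one
  let g : Lp ℂ 2 q := (InnerProductSpace.toDual ℂ (Lp ℂ 2 q)).symm (L.comp incl)
  have hg : Integrable g q := (Lp.memLp g).integrable one_le_two
  refine ⟨fun x => conj (g x), (ContinuousLinearEquiv.integrable_comp_iff
    Complex.conjCLE.toContinuousLinearEquiv).2 hg, fun E hE => ?_⟩
  have hincl : incl (indicatorConstLp 2 hE (measure_ne_top q E) 1)
      = indicatorConstLp 1 hE (measure_ne_top q E) 1 := by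
    refine Lp.ext ?_
    filter_upwards [ContinuousLinearMap.coeFn_holder (r := 1) (ContinuousLinearMap.mul ℂ ℂ) one
      (indicatorConstLp 2 hE (measure_ne_top q E) 1), AEEqFun.coeFn_const (μ := q) X (1 : ℂ),
      indicatorConstLp_coeFn (p := 2) (hs := hE) (hμs := measure_ne_top q E) (c := (1 : ℂ)),
      indicatorConstLp_coeFn (p := 1) (hs := hE) (hμs := measure_ne_top q E) (c := (1 : ℂ))]
      with x h1 h2 h3 h4
    rw [h4, ← h3]
    refine h1.trans ?_
    rw [ContinuousLinearMap.mul_apply', show one x = 1 from h2, one_mul]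
  calc L (indicatorConstLp 1 hE (measure_ne_top q E) 1)
      = ⟪g, indicatorConstLp 2 hE (measure_ne_top q E) 1⟫_ℂ := by
        rw [InnerProductSpace.toDual_symm_apply, ← hincl]; rfl
    _ = conj (∫ x in E, g x ∂q) := by rw [← inner_conj_symm, L2.inner_indicatorConstLp_one]
    _ = ∫ x in E, conj (g x) ∂q := integral_conj.symm

theorem dual_L1_ext {L M : StrongDual ℂ (Lp ℂ 1 q)}
    (h : ∀ (E : Set X) (hE : MeasurableSet E),
      L (indicatorConstLp 1 hE (measure_ne_top q E) 1)
        = M (indicatorConstLp 1 hE (measure_ne_top q E) 1)) : L = M := by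
  ext f
  induction f using Lp.induction ENNReal.one_ne_top with
  | @indicatorConst c E hE hq =>
    rw [Lp.simpleFunc.coe_indicatorConst]
    have hc : indicatorConstLp 1 hE hq.ne c = c • indicatorConstLp 1 hE hq.ne (1 : ℂ) := by
      rw [indicatorConstLp, indicatorConstLp, ← MemLp.toLp_const_smul]
      congr 1
      ext x
      by_cases hx : x ∈ E <;> simp [hx]
    rw [hc, map_smul, map_smul, h]
  | add _ _ _ hf hg => rw [map_add, map_add, hf, hg]
  | isClosed => exact isClosed_eq L.continuous M.continuous

theorem exists_boundedMeasurable_eq_of_dual_L1 (L : StrongDual ℂ (Lp ℂ 1 q)) :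
    ∃ g : X → ℂ, BoundedMeasurable g ∧ ∀ f : Lp ℂ 1 q, L f = ∫ x, g x * f x ∂q := by
  obtain ⟨k, hk, hLk⟩ := exists_setIntegral_eq_of_dual_L1 q L
  have hbound : ∀ᵐ x ∂q, ‖k x‖ ≤ ‖L‖ :=
    ae_norm_le_of_forall_norm_setIntegral_le q hk (norm_nonneg L) fun E hE => by
      rw [← hLk E hE]
      refine (L.le_opNorm _).trans_eq ?_
      rw [norm_indicatorConstLp one_ne_zero ENNReal.one_ne_top]
      simp
  obtain ⟨g, hg, hgk⟩ := exists_boundedMeasurable_ae_eq hk.1.aemeasurable (norm_nonneg L) hbound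
  have hg_mem : MemLp g ∞ q := by
    obtain ⟨C, hC⟩ := hg.bounded
    exact .of_bound hg.measurable.aestronglyMeasurable C (.of_forall hC)
  let M : StrongDual ℂ (Lp ℂ 1 q) := (ContinuousLinearMap.mul ℂ ℂ).lpPairing q ∞ 1 hg_mem.toLp
  have hM : ∀ f, M f = ∫ x, g x * f x ∂q := fun f => by
    refine (ContinuousLinearMap.lpPairing_eq_integral _ _ _).trans (integral_congr_ae ?_)
    filter_upwards [hg_mem.coeFn_toLp] with x hx
    rw [hx, ContinuousLinearMap.mul_apply']
  suffices h : L = M from ⟨g, hg, fun f => h ▸ hM f⟩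
  refine dual_L1_ext q fun E hE => ?_
  rw [hLk E hE, hM, ← MeasureTheory.integral_indicator hE]
  refine integral_congr_ae ?_
  filter_upwards [hgk, indicatorConstLp_coeFn (p := 1) (hs := hE) (hμs := measure_ne_top q E)
    (c := (1 : ℂ))] with x hx hxE
  by_cases h : x ∈ E <;> simp [hxE, h, hx]

end Density

section FunctionalDensity

variable {S : Type u} [TopologicalSpace S] [T2Space S] [MeasurableSpace S] [BorelSpace S]
  (q : Measure S) [IsFiniteMeasure q] [q.Regular]

/-- The measure `h q` with density `h ∈ L¹(q)`. -/
def withDensityL1 (h : Lp ℂ 1 q) : RegMeasure S :=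
  ⟨q.withDensityᵥ h, by
    have hh : Integrable h q := L1.integrable_coeFn h
    have : IsFiniteMeasure (q.withDensity (‖h ·‖ₑ)) := isFiniteMeasure_withDensity hh.2.ne
    change ((q.withDensityᵥ h).variation).Regular
    rw [Measure.variation_withDensityᵥ hh]
    exact regular_of_absolutelyContinuous (withDensity_absolutelyContinuous q _)⟩

theorem withDensityL1_apply (h : Lp ℂ 1 q) {E : Set S} (hE : MeasurableSet E) :
    (withDensityL1 q h : ComplexMeasure S) E = ∫ x in E, h x ∂q :=
  withDensityᵥ_apply (L1.integrable_coeFn h) hE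

theorem norm_withDensityL1 (h : Lp ℂ 1 q) : ‖withDensityL1 q h‖ = ‖h‖ := by
  rw [regMeasure_norm_def, withDensityL1, measureReal_def,
    Measure.variation_withDensityᵥ (L1.integrable_coeFn h), withDensity_apply _ .univ,
    Measure.restrict_univ, L1.norm_def]

/-- The embedding of `L¹(q)` in `M(S)`. -/
def withDensityCLM : Lp ℂ 1 q →L[ℂ] RegMeasure S :=
  LinearMap.mkContinuous
    { toFun := withDensityL1 q
      map_add' := fun f g => regMeasure_ext fun E hE => by
        have hf := (L1.integrable_coeFn f).integrableOn (s := E)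
        have hg := (L1.integrable_coeFn g).integrableOn (s := E)
        simp only [Submodule.coe_add, FunLike.coe_add, Pi.add_apply, withDensityL1_apply _ _ hE]
        rw [← MeasureTheory.integral_add hf hg]
        exact integral_congr_ae (ae_restrict_of_ae (Lp.coeFn_add f g))
      map_smul' := fun c f => regMeasure_ext fun E hE => by
        simp only [Submodule.coe_smul, FunLike.coe_smul, Pi.smul_apply, RingHom.id_apply,
          withDensityL1_apply _ _ hE]
        rw [← MeasureTheory.integral_smul]
        exact integral_congr_ae (ae_restrict_of_ae (Lp.coeFn_smul c f)) } 1
    fun h => by simpa using (norm_withDensityL1 q h).le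

theorem exists_density_of_functional (F : StrongDual ℂ (RegMeasure S)) :
    ∃ g : S → ℂ, BoundedMeasurable g ∧ ∀ (p : Measure S) [IsFiniteMeasure p] [p.Regular],
      p ≪ q → F (ofMeasure p) = ∫ x, g x ∂p := by
  obtain ⟨g, hg, hFg⟩ := exists_boundedMeasurable_eq_of_dual_L1 q (F.comp (withDensityCLM q))
  refine ⟨g, hg, fun p _ _ hpq => ?_⟩
  have hint : Integrable (fun x => ((p.rnDeriv q x).toReal : ℂ)) q :=
    Measure.integrable_toReal_rnDeriv.ofReal
  have hp : withDensityCLM q hint.toL1 = ofMeasure p := regMeasure_ext fun E hE => by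
    refine (withDensityL1_apply q _ hE).trans ?_
    rw [ofMeasure_apply _ hE, setIntegral_congr_ae hE
      (hint.coeFn_toL1.mono fun x hx _ => hx), integral_complex_ofReal,
      Measure.setIntegral_toReal_rnDeriv hpq]
  rw [← hp]
  refine (hFg _).trans ?_
  rw [← integral_rnDeriv_smul hpq]
  refine integral_congr_ae (hint.coeFn_toL1.mono fun x hx => ?_)
  simp only [hx, Complex.real_smul, mul_comm]

end FunctionalDensity

/-! ### Setwise continuous families of measures -/

section SetwiseContinuous

variable {X S : Type*} [TopologicalSpace X] [MeasurableSpace S]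

/-- A family of measures is setwise continuous if its value on each measurable set depends
continuously on the parameter. For locally compact parameter spaces this turns out to be weak
continuity in `M(S)`, see `setwiseContinuous_iff_continuous_toWeakSpace`. -/
def SetwiseContinuous (θ : X → Measure S) : Prop :=
  ∀ E, MeasurableSet E → Continuous fun x => (θ x).real E

namespace SetwiseContinuous

variable {θ : X → Measure S}

theorem comp {Y : Type*} [TopologicalSpace Y] (hθ : SetwiseContinuous θ) {f : Y → X}
    (hf : Continuous f) : SetwiseContinuous fun y => θ (f y) :=
  fun E hE => (hθ E hE).comp hf

theorem map {Y : Type*} [MeasurableSpace Y] (hθ : SetwiseContinuous θ) {f : S → Y}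
    (hf : Measurable f) : SetwiseContinuous fun x => (θ x).map f := fun E hE => by
  simpa only [map_measureReal_apply hf hE] using hθ _ (hf hE)

theorem exists_measureReal_univ_le [CompactSpace X] (hθ : SetwiseContinuous θ) :
    ∃ C, ∀ x, (θ x).real Set.univ ≤ C := by
  obtain ⟨C, hC⟩ := (isCompact_range (hθ _ .univ)).bddAbove
  exact ⟨C, fun x => hC ⟨x, rfl⟩⟩

theorem const_smul (hθ : SetwiseContinuous θ) (c : NNReal) :
    SetwiseContinuous fun x => c • θ x := fun E hE => by
  simpa only [measureReal_nnreal_smul_apply] using (hθ E hE).const_mul (c : ℝ)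

variable [∀ x, IsFiniteMeasure (θ x)]

theorem add {θ' : X → Measure S} [∀ x, IsFiniteMeasure (θ' x)] (hθ : SetwiseContinuous θ)
    (hθ' : SetwiseContinuous θ') : SetwiseContinuous fun x => θ x + θ' x := fun E hE =>
  ((hθ E hE).fun_add (hθ' E hE)).congr fun _ => (measureReal_add_apply ..).symm

theorem measurable [MeasurableSpace X] [BorelSpace X] (hθ : SetwiseContinuous θ) :
    Measurable θ :=
  Measure.measurable_of_measurable_coe _ fun E hE => by
    convert (hθ E hE).measurable.ennreal_ofReal using 2
    exact (ofReal_measureReal (measure_ne_top _ _)).symm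

variable [CompactSpace X]

theorem integral (hθ : SetwiseContinuous θ) {g : S → ℂ} (hg : BoundedMeasurable g) :
    Continuous fun x => ∫ y, g y ∂θ x := by
  obtain ⟨C, hC⟩ := hθ.exists_measureReal_univ_le
  induction hg using BoundedMeasurable.induction with
  | indicator c E hE =>
    simp only [MeasureTheory.integral_indicator_const _ hE]
    exact (hθ E hE).smul continuous_const
  | add f g hf hg hf_cont hg_cont =>
    simp only [Pi.add_apply, MeasureTheory.integral_add (hf.integrable _) (hg.integrable _)]
    exact hf_cont.add hg_cont
  | lim g f hg hf hlim hg_cont =>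
    exact (tendstoUniformly_integral hg hf hlim θ hC).continuous (.of_forall hg_cont)

theorem exists_forall_measureReal_lt (hθ : SetwiseContinuous θ) {G : ℕ → Set S}
    (hG : ∀ n, MeasurableSet (G n)) (hanti : Antitone G) (hempty : ⋂ n, G n = ∅) {ε : ℝ}
    (hε : 0 < ε) : ∃ n, ∀ x, (θ x).real (G n) < ε := by
  have hlim (x : X) : Filter.Tendsto (fun n => (θ x).real (G n)) Filter.atTop (𝓝 0) := by
    have h := tendsto_measure_iInter_atTop (μ := θ x) (fun n => (hG n).nullMeasurableSet) hanti
      ⟨0, measure_ne_top _ _⟩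
    rw [hempty, measure_empty] at h
    exact (ENNReal.tendsto_toReal ENNReal.zero_ne_top).comp h
  have hunif := Antitone.tendstoUniformly_of_forall_tendsto (fun n => hθ _ (hG n))
    (fun n m hnm x => measureReal_mono (hanti hnm)) continuous_const hlim
  obtain ⟨n, hn⟩ := (Metric.tendstoUniformly_iff.1 hunif ε hε).exists
  refine ⟨n, fun x => ?_⟩
  simpa [abs_of_nonneg measureReal_nonneg] using hn x

theorem exists_measureReal_lt (hθ : SetwiseContinuous θ) {x : ℕ → X} {A : ℕ → Set S}
    (hA : ∀ n, MeasurableSet (A n)) (hsmall : ∀ i n, i < n → (θ (x i)).real (A n) ≤ (1 / 2) ^ n)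
    {ε : ℝ} (hε : 0 < ε) : ∃ n, (θ (x n)).real (A n) < ε := by
  let N : Set S := Filter.limsup A Filter.atTop
  have hN : MeasurableSet N := .measurableSet_limsup hA
  have hnull (i : ℕ) : θ (x i) N = 0 := by
    have hle (n : ℕ) : θ (x i) (A (n + (i + 1))) ≤ ENNReal.ofReal ((1 / 2) ^ n) := by
      rw [← ofReal_measureReal]
      refine ENNReal.ofReal_le_ofReal ((hsmall i _ (by omega)).trans ?_)
      exact pow_le_pow_of_le_one (by norm_num) (by norm_num) (Nat.le_add_right n _)
    have hN_eq : N = Filter.limsup (fun n => A (n + (i + 1))) Filter.atTop :=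
      (Filter.limsup_nat_add A (i + 1)).symm
    rw [hN_eq]
    refine measure_limsup_atTop_eq_zero (ne_top_of_le_ne_top ?_ (ENNReal.tsum_le_tsum hle))
    rw [← ENNReal.ofReal_tsum_of_nonneg (fun n => by positivity) summable_geometric_two]
    exact ENNReal.ofReal_ne_top
  have hempty : ⋂ n, (⋃ i, A (i + n)) \ N = ∅ := by
    simp only [Set.sdiff_eq]
    rw [← Set.iInter_inter, ← Set.sdiff_eq, Set.sdiff_eq_empty]
    exact Filter.limsup_eq_iInf_iSup_of_nat'.ge
  obtain ⟨n, hn⟩ := hθ.exists_forall_measureReal_lt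
    (fun n => (MeasurableSet.iUnion fun i => hA (i + n)).diff hN)
    (antitone_nat_of_succ_le fun n => Set.sdiff_subset_sdiff_left <| Set.iUnion_subset fun i =>
      Set.subset_iUnion_of_subset (i + 1) (by rw [add_right_comm, add_assoc])) hempty hε
  refine ⟨n, lt_of_le_of_lt ?_ (hn (x n))⟩
  rw [measureReal_def, ← measure_sdiff_null (hnull n), ← measureReal_def]
  exact measureReal_mono (Set.sdiff_subset_sdiff_left (Set.subset_iUnion_of_subset 0 (by simp)))

theorem exists_finset_control (hθ : SetwiseContinuous θ) {ε : ℝ} (hε : 0 < ε) :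
    ∃ (t : Finset X) (δ : ℝ), 0 < δ ∧ ∀ E, MeasurableSet E → (∀ y ∈ t, (θ y).real E < δ) →
      ∀ x, (θ x).real E < ε := by
  classical
  by_contra! hcon
  obtain ⟨f, hf, hf_small⟩ := exists_seq_of_forall_finset_exists
    (fun a : ℕ × X × Set S => MeasurableSet a.2.2 ∧ ε ≤ (θ a.2.1).real a.2.2)
    (fun a b => a.1 < b.1 ∧ (θ a.2.1).real b.2.2 ≤ (1 / 2) ^ b.1) fun s _ => by
      obtain ⟨E, hE, hlt, x, hx⟩ := hcon (s.image fun a => a.2.1)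
        ((1 / 2) ^ (s.sup Prod.fst + 1)) (by positivity)
      exact ⟨(s.sup Prod.fst + 1, x, E), ⟨hE, hx⟩, fun a ha =>
        ⟨Nat.lt_succ_of_le (Finset.le_sup ha), (hlt _ (Finset.mem_image_of_mem _ ha)).le⟩⟩
  have hle (n : ℕ) : n ≤ (f n).1 :=
    (strictMono_nat_of_lt_succ fun n => (hf_small n _ n.lt_succ_self).1).le_apply
  obtain ⟨n, hn⟩ := hθ.exists_measureReal_lt (fun n => (hf n).1)
    (fun i n hin => (hf_small i n hin).2.trans
      (pow_le_pow_of_le_one (by norm_num) (by norm_num) (hle n))) hε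
  exact hn.not_ge (hf n).2

end SetwiseContinuous

end SetwiseContinuous

section Domination

variable {X : Type*} [TopologicalSpace X] {S : Type u} [TopologicalSpace S] [T2Space S]
  [MeasurableSpace S] [BorelSpace S]

theorem exists_forall_absolutelyContinuous {ι : Type*} [Countable ι] (m : ι → Measure S)
    [∀ i, IsFiniteMeasure (m i)] [∀ i, (m i).Regular] :
    ∃ (q : Measure S) (_ : IsFiniteMeasure q) (_ : q.Regular), ∀ i, m i ≪ q :=
  ⟨(Measure.sum m).toFinite, inferInstance,
    regular_of_absolutelyContinuous_sum m (toFinite_absolutelyContinuous _),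
    fun i => (Measure.le_sum m i).absolutelyContinuous.trans (absolutelyContinuous_toFinite _)⟩

variable {θ : X → Measure S} [∀ x, IsFiniteMeasure (θ x)] [∀ x, (θ x).Regular]

namespace SetwiseContinuous

theorem exists_absolutelyContinuous [CompactSpace X] (hθ : SetwiseContinuous θ) :
    ∃ (q : Measure S) (_ : IsFiniteMeasure q) (_ : q.Regular), ∀ x, θ x ≪ q := by
  choose t δ hδ ht using fun n : ℕ =>
    hθ.exists_finset_control (Nat.one_div_pos_of_nat (n := n) (α := ℝ))
  have : Countable ↥(⋃ n, (t n : Set X)) :=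
    (Set.countable_iUnion fun n => (t n).countable_toSet).to_subtype
  obtain ⟨q, hq_fin, hq_reg, hq⟩ :=
    exists_forall_absolutelyContinuous fun y : ↥(⋃ n, (t n : Set X)) => θ y
  refine ⟨q, hq_fin, hq_reg, fun x => .mk fun E hE hqE => ?_⟩
  have hlt (n : ℕ) : (θ x).real E < 1 / ((n : ℝ) + 1) :=
    ht n E hE (fun y hy => by
      rw [measureReal_def, hq ⟨y, Set.mem_iUnion_of_mem n hy⟩ hqE]
      exact hδ n) x
  refine (measureReal_eq_zero_iff).1 (le_antisymm ?_ measureReal_nonneg)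
  exact ge_of_tendsto' tendsto_one_div_add_atTop_nhds_zero_nat fun n => (hlt n).le

theorem exists_ae_absolutelyContinuous [T2Space X] [MeasurableSpace X] [BorelSpace X]
    (hθ : SetwiseContinuous θ) (p : Measure X) [IsFiniteMeasure p] [p.Regular] :
    ∃ (q : Measure S) (_ : IsFiniteMeasure q) (_ : q.Regular), ∀ᵐ x ∂p, θ x ≪ q := by
  choose K _ hK hKp using fun n : ℕ => exists_isCompact_diff_lt_of_regular p
    MeasurableSet.univ (ε := (n : ℝ≥0∞)⁻¹) (by simp)
  have hKcompact (n : ℕ) : CompactSpace (K n) := isCompact_iff_compactSpace.1 (hK n)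
  choose r hr_fin hr_reg hr using fun n =>
    (hθ.comp (continuous_subtype_val (p := (· ∈ K n)))).exists_absolutelyContinuous
  obtain ⟨q, hq_fin, hq_reg, hq⟩ := exists_forall_absolutelyContinuous r
  refine ⟨q, hq_fin, hq_reg, ?_⟩
  have hnull : p (⋂ n, (Set.univ \ K n)) = 0 :=
    le_antisymm (ge_of_tendsto' ENNReal.tendsto_inv_nat_nhds_zero fun n =>
      (measure_mono (Set.iInter_subset _ n)).trans (hKp n).le) zero_le
  filter_upwards [measure_eq_zero_iff_ae_notMem.1 hnull] with x hx
  simp only [Set.mem_iInter, Set.mem_sdiff, Set.mem_univ, true_and, not_forall, not_not] at hx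
  obtain ⟨n, hn⟩ := hx
  exact (hr n ⟨x, hn⟩).trans (hq n)

theorem continuous_functional_of_compactSpace [CompactSpace X] (hθ : SetwiseContinuous θ)
    (F : StrongDual ℂ (RegMeasure S)) : Continuous fun x => F (ofMeasure (θ x)) := by
  obtain ⟨q, _, _, hq⟩ := hθ.exists_absolutelyContinuous
  obtain ⟨g, hg, hF⟩ := exists_density_of_functional q F
  simpa only [hF _ (hq _)] using hθ.integral hg

theorem continuous_functional [WeaklyLocallyCompactSpace X] (hθ : SetwiseContinuous θ)
    (F : StrongDual ℂ (RegMeasure S)) : Continuous fun x => F (ofMeasure (θ x)) := by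
  refine continuous_iff_continuousAt.2 fun x => ?_
  obtain ⟨K, hK, hx⟩ := exists_compact_mem_nhds x
  have : CompactSpace K := isCompact_iff_compactSpace.1 hK
  have hθK := hθ.comp (continuous_subtype_val (p := (· ∈ K)))
  have h := hθK.continuous_functional_of_compactSpace F
  exact (continuousOn_iff_continuous_domRestrict.2 h).continuousAt hx

end SetwiseContinuous

theorem setwiseContinuous_iff_continuous_toWeakSpace [WeaklyLocallyCompactSpace X] :
    SetwiseContinuous θ ↔
      Continuous fun x => toWeakSpace ℂ (RegMeasure S) (ofMeasure (θ x)) := by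
  refine ⟨fun h => WeakBilin.continuous_of_continuous_eval _ h.continuous_functional,
    fun h E hE => ?_⟩
  let F := integralCLM (BoundedMeasurable.indicator_const (1 : ℂ) hE)
  have hF : Continuous fun x => F (ofMeasure (θ x)) :=
    (WeakBilin.eval_continuous (topDualPairing ℂ (RegMeasure S)).flip F).comp h
  have hF_apply (x : X) : F (ofMeasure (θ x)) = (θ x).real E := by
    rw [integralCLM_apply, integral_indicator _ hE, ofMeasure_apply _ hE, one_mul]
  simp_rw [hF_apply] at hF
  exact Complex.continuous_re.comp hF

end Domination

/-! ### Measures with setwise continuous translates -/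

instance regular_map_continuousMap {S : Type*} [TopologicalSpace S] [T2Space S] [MeasurableSpace S]
    [BorelSpace S] (p : Measure S) [IsFiniteMeasure p] [p.Regular] (T : C(S, S)) :
    (p.map T).Regular :=
  regular_map p T.continuous

theorem abs_integral_le_mul_measureReal {S : Type*} [MeasurableSpace S] {p : Measure S}
    [IsFiniteMeasure p] {φ : S → ℝ} {D : Set S} (hD : MeasurableSet D) {C : ℝ}
    (hφ : ∀ y, |φ y| ≤ C * D.indicator 1 y) :
    |∫ y, φ y ∂p| ≤ C * p.real D := by
  have hint : Integrable (D.indicator (1 : S → ℝ)) p := (integrable_const 1).indicator hD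
  rw [← integral_indicator_one hD, ← MeasureTheory.integral_const_mul]
  exact norm_integral_le_of_norm_le (f := φ) (hint.const_mul C) (.of_forall hφ)

section Heredity

variable {X : Type*} [TopologicalSpace X] {S : Type*} [TopologicalSpace S] [T2Space S]
  [LocallyCompactSpace S] [MeasurableSpace S] [BorelSpace S]

theorem exists_continuous_abs_indicator_sub_le (r : Measure S) [IsFiniteMeasure r] [r.Regular]
    {E : Set S} (hE : MeasurableSet E) {δ : ℝ} (hδ : 0 < δ) :
    ∃ (h : C(S, ℝ)) (D : Set S), HasCompactSupport h ∧ MeasurableSet D ∧ r.real D < δ ∧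
      (∀ y, |h y| ≤ 1) ∧ ∀ y, |E.indicator 1 y - h y| ≤ D.indicator 1 y := by
  have hδ_half : ENNReal.ofReal (δ / 2) ≠ 0 := by simpa using hδ
  obtain ⟨A, hAE, hA, hA_lt⟩ := exists_isCompact_diff_lt_of_regular r hE hδ_half
  obtain ⟨V, hEV, hV, -, hV_lt⟩ := hE.exists_isOpen_sdiff_lt (measure_ne_top r E) hδ_half
  obtain ⟨h, h_one, h_zero, h_supp, h_mem⟩ := exists_continuous_one_zero_of_isCompact hA
    hV.isClosed_compl (Set.disjoint_compl_right_iff_subset.2 (hAE.trans hEV))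
  refine ⟨h, V \ A, h_supp, hV.measurableSet.diff hA.measurableSet, ?_,
    fun y => abs_le.2 ⟨by linarith [(h_mem y).1], (h_mem y).2⟩, fun y => ?_⟩
  · refine (ENNReal.lt_ofReal_iff_toReal_lt (measure_ne_top _ _)).1 ?_
    calc r (V \ A) ≤ r (V \ E) + r (E \ A) :=
          (measure_mono (sdiff_triangle V E A)).trans (measure_union_le _ _)
      _ < ENNReal.ofReal (δ / 2) + ENNReal.ofReal (δ / 2) := ENNReal.add_lt_add hV_lt hA_lt
      _ = ENNReal.ofReal δ := by
        rw [← ENNReal.ofReal_add (by positivity) (by positivity), add_halves]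
  · by_cases hyA : y ∈ A
    · simp [hyA, hAE hyA, h_one hyA]
    by_cases hyV : y ∈ V
    · by_cases hyE : y ∈ E <;>
        simp [hyA, hyV, hyE, abs_le] <;> constructor <;> linarith [(h_mem y).1, (h_mem y).2]
    · have hyE : y ∉ E := fun hy => hyV (hEV hy)
      simp [hyV, hyE, h_zero hyV]

theorem continuous_integral_of_bounded {f : X → S → ℝ} (hf : Continuous (Function.uncurry f))
    {C : ℝ} (hC : ∀ x y, |f x y| ≤ C) (p : Measure S) [IsFiniteMeasure p] [p.Regular] :
    Continuous fun x => ∫ y, f x y ∂p := by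
  refine continuous_of_uniform_approx_of_continuous fun U hU => ?_
  obtain ⟨ε, hε, hεU⟩ := Metric.mem_uniformity_dist.1 hU
  obtain ⟨h, D, h_supp, hD, hpD, h_le, hhD⟩ := exists_continuous_abs_indicator_sub_le p .univ
    (δ := ε / (|C| + 1)) (by positivity)
  have hcont : Continuous (Function.uncurry fun x y => f x y * h y) :=
    hf.mul (h.continuous.comp continuous_snd)
  refine ⟨fun x => ∫ y, f x y * h y ∂p, continuousOn_univ.1 <|
    continuousOn_integral_of_compact_support h_supp.isCompact hcont.continuousOn
      fun x y _ hy => by rw [image_eq_zero_of_notMem_tsupport hy, mul_zero], fun x => hεU ?_⟩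
  have hint {g : S → ℝ} (hg : Continuous g) {B : ℝ} (hB : ∀ y, |g y| ≤ B) : Integrable g p :=
    .of_bound hg.aestronglyMeasurable B (.of_forall hB)
  rw [Real.dist_eq, ← MeasureTheory.integral_sub (hint (by fun_prop) (hC x))
    (hint (B := C) (by fun_prop) fun y => ?_)]
  rotate_left
  · rw [abs_mul]
    exact (mul_le_of_le_one_right (abs_nonneg _) (h_le y)).trans (hC x y)
  refine (abs_integral_le_mul_measureReal (C := |C| + 1) hD fun y => ?_).trans_lt ?_
  · have hhDy : |1 - h y| ≤ D.indicator 1 y := by simpa using hhD y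
    rw [← mul_one_sub, abs_mul]
    gcongr
    linarith [hC x y, le_abs_self C]
  · rwa [lt_div_iff₀' (by positivity)] at hpD

theorem SetwiseContinuous.of_le_of_compactSpace [CompactSpace X] {T : X → C(S, S)}
    (hT : Continuous fun z : X × S => T z.1 z.2) {p q : Measure S} [IsFiniteMeasure p] [p.Regular]
    (hp : SetwiseContinuous fun x => p.map (T x)) (hqp : q ≤ p) :
    SetwiseContinuous fun x => q.map (T x) := by
  intro E hE
  have : IsFiniteMeasure q := isFiniteMeasure_of_le p hqp
  have := regular_of_le hqp
  refine continuous_of_uniform_approx_of_continuous fun U hU => ?_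
  obtain ⟨ε, hε, hεU⟩ := Metric.mem_uniformity_dist.1 hU
  obtain ⟨t, δ, hδ, ht⟩ := hp.exists_finset_control hε
  obtain ⟨r, _, _, hr⟩ : ∃ (r : Measure S) (_ : IsFiniteMeasure r) (_ : r.Regular),
      ∀ y ∈ t, p.map (T y) ≤ r :=
    ⟨Measure.sum fun y : t => p.map (T y), inferInstance,
      regular_of_absolutelyContinuous_sum _ Measure.AbsolutelyContinuous.rfl,
      fun y hy => Measure.le_sum (fun y : t => p.map (T y)) ⟨y, hy⟩⟩
  obtain ⟨h, D, -, hD, hrD, h_le, hhD⟩ := exists_continuous_abs_indicator_sub_le r hE hδ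
  have hsmall (x : X) : (p.map (T x)).real D < ε :=
    ht D hD (fun y hy => (ENNReal.toReal_mono (measure_ne_top _ _) (hr y hy D)).trans_lt hrD) x
  refine ⟨fun x => ∫ y, h (T x y) ∂q,
    continuous_integral_of_bounded (f := fun x y => h (T x y)) (h.continuous.comp hT)
      (fun x y => h_le _) q,
    fun x => hεU (lt_of_le_of_lt ?_ (hsmall x))⟩
  have hTx : Measurable (T x) := (T x).continuous.measurable
  have h_map : ∫ y, h (T x y) ∂q = ∫ y, h y ∂q.map (T x) :=
    (integral_map hTx.aemeasurable h.continuous.aestronglyMeasurable).symm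
  have h_cont : Integrable h (q.map (T x)) :=
    .of_bound h.continuous.aestronglyMeasurable 1 (.of_forall h_le)
  beta_reduce
  have h_ind : Integrable (E.indicator (1 : S → ℝ)) (q.map (T x)) :=
    (integrable_const 1).indicator hE
  rw [h_map, Real.dist_eq, ← integral_indicator_one hE,
    ← MeasureTheory.integral_sub h_ind h_cont]
  refine (abs_integral_le_mul_measureReal (C := 1) hD fun y => ?_).trans ?_
  · simpa using hhD y
  · rw [one_mul]
    exact ENNReal.toReal_mono (measure_ne_top _ _) (Measure.map_mono hqp hTx D)

theorem SetwiseContinuous.of_le [WeaklyLocallyCompactSpace X] {T : X → C(S, S)}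
    (hT : Continuous fun z : X × S => T z.1 z.2) {p q : Measure S} [IsFiniteMeasure p] [p.Regular]
    (hp : SetwiseContinuous fun x => p.map (T x)) (hqp : q ≤ p) :
    SetwiseContinuous fun x => q.map (T x) := by
  refine fun E hE => continuous_iff_continuousAt.2 fun x => ?_
  obtain ⟨K, hK, hx⟩ := exists_compact_mem_nhds x
  have : CompactSpace K := isCompact_iff_compactSpace.1 hK
  have h := SetwiseContinuous.of_le_of_compactSpace (X := K) (T := fun x => T x)
    (hT.comp (continuous_subtype_val.prodMap continuous_id))
    (hp.comp continuous_subtype_val) hqp E hE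
  exact (continuousOn_iff_continuous_domRestrict.2 h).continuousAt hx

end Heredity

section Pushforward

variable {S : Type u} [TopologicalSpace S] [T2Space S] [MeasurableSpace S] [BorelSpace S]

omit [T2Space S] in
theorem map_map_continuousMap (p : Measure S) (f g : C(S, S)) :
    (p.map g).map f = p.map (f.comp g) :=
  Measure.map_map f.continuous.measurable g.continuous.measurable

theorem pushforward_ofMeasure (T : C(S, S)) (p : Measure S) [IsFiniteMeasure p] [p.Regular] :
    pushforward T (ofMeasure p) = ofMeasure (p.map T) := regMeasure_ext fun E hE => by
  rw [pushforward_apply T _ hE, ofMeasure_apply _ (T.continuous.measurable hE),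
    ofMeasure_apply _ hE, map_measureReal_apply T.continuous.measurable hE]

theorem norm_pushforward_le (T : C(S, S)) (μ : RegMeasure S) : ‖pushforward T μ‖ ≤ ‖μ‖ := by
  rw [regMeasure_norm_def, regMeasure_norm_def]
  refine (ENNReal.toReal_mono (measure_ne_top _ _)
    (VectorMeasure.variation_map_le Set.univ)).trans_eq ?_
  exact map_measureReal_apply T.continuous.measurable .univ

/-- The push-forward under a continuous map, as a bounded operator on `M(S)`. -/
def pushforwardCLM (T : C(S, S)) : RegMeasure S →L[ℂ] RegMeasure S :=
  LinearMap.mkContinuous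
    { toFun := pushforward T
      map_add' := fun μ ν => regMeasure_ext fun E hE => by simp [pushforward_apply T _ hE]
      map_smul' := fun c μ => regMeasure_ext fun E hE => by simp [pushforward_apply T _ hE] } 1
    fun μ => (norm_pushforward_le T μ).trans_eq (one_mul _).symm

theorem pushforwardCLM_apply (T : C(S, S)) (μ : RegMeasure S) :
    pushforwardCLM T μ = pushforward T μ := rfl

theorem norm_pushforwardCLM_le (T : C(S, S)) : ‖pushforwardCLM T‖ ≤ 1 :=
  LinearMap.mkContinuous_norm_le _ zero_le_one _

end Pushforward

section Translation

open ContinuousMap (mulLeft mulRight)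

variable {S : Type u} [Monoid S] [TopologicalSpace S] [ContinuousMul S] [MeasurableSpace S]

/-- A positive measure is translation continuous if its right and left translates depend setwise
continuously on the translation. The measures in `L(S)` are those whose total variation is
translation continuous, see `mem_semigroupAlgebra_iff`. -/
def IsTranslationContinuous (p : Measure S) : Prop :=
  SetwiseContinuous (fun x => p.map (mulRight x)) ∧ SetwiseContinuous fun x => p.map (mulLeft x)

variable [BorelSpace S]

theorem mem_semigroupAlgebra_iff [T2Space S] [WeaklyLocallyCompactSpace S] {μ : RegMeasure S} :
    μ ∈ semigroupAlgebra S ↔ IsTranslationContinuous (μ : ComplexMeasure S).variation := by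
  simp only [IsTranslationContinuous, setwiseContinuous_iff_continuous_toWeakSpace,
    ← pushforward_ofMeasure, ← absMeasure_eq_ofMeasure]
  rfl

theorem map_mulLeft_map_mulLeft (p : Measure S) (x y : S) :
    (p.map (mulLeft x)).map (mulLeft y) = p.map (mulLeft (y * x)) := by
  rw [map_map_continuousMap, ContinuousMap.mulLeft_mul]

theorem map_mulLeft_map_mulRight (p : Measure S) (x y : S) :
    (p.map (mulLeft x)).map (mulRight y) = (p.map (mulRight y)).map (mulLeft x) := by
  rw [map_map_continuousMap, map_map_continuousMap]
  congr 1; ext z; simp [mul_assoc]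

namespace IsTranslationContinuous

variable {p q : Measure S}

omit [BorelSpace S] in
theorem zero : IsTranslationContinuous (0 : Measure S) := by
  constructor <;> intro _ _ <;> simp [continuous_const]

theorem add [IsFiniteMeasure p] [IsFiniteMeasure q] (hp : IsTranslationContinuous p)
    (hq : IsTranslationContinuous q) : IsTranslationContinuous (p + q) := by
  simp only [IsTranslationContinuous, Measure.map_add _ _ (ContinuousMap.measurable _)]
  exact ⟨hp.1.add hq.1, hp.2.add hq.2⟩

omit [BorelSpace S] in
theorem smul (hp : IsTranslationContinuous p) (c : NNReal) : IsTranslationContinuous (c • p) := by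
  simp only [IsTranslationContinuous, Measure.map_smul]
  exact ⟨hp.1.const_smul c, hp.2.const_smul c⟩

theorem map_mulLeft (hp : IsTranslationContinuous p) (y : S) :
    IsTranslationContinuous (p.map (mulLeft y)) := by
  simp only [IsTranslationContinuous, map_mulLeft_map_mulRight, map_mulLeft_map_mulLeft]
  exact ⟨hp.1.map (mulLeft y).continuous.measurable, hp.2.comp (continuous_mul_const y)⟩

theorem map_star [StarMul S] [ContinuousStar S] (hp : IsTranslationContinuous p) :
    IsTranslationContinuous (p.map (starContinuousMap : C(S, S))) := by
  have h_right (x : S) : (p.map (starContinuousMap : C(S, S))).map (mulRight x) =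
      (p.map (mulLeft (star x))).map (starContinuousMap : C(S, S)) := by
    simp only [map_map_continuousMap]
    congr 1; ext z; simp
  have h_left (x : S) : (p.map (starContinuousMap : C(S, S))).map (mulLeft x) =
      (p.map (mulRight (star x))).map (starContinuousMap : C(S, S)) := by
    simp only [map_map_continuousMap]
    congr 1; ext z; simp
  simp only [IsTranslationContinuous, h_right, h_left]
  exact ⟨(hp.2.comp continuous_star).map continuous_star.measurable,
    (hp.1.comp continuous_star).map continuous_star.measurable⟩

variable [T2Space S] [LocallyCompactSpace S] [IsFiniteMeasure p] [p.Regular]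

theorem of_le (hp : IsTranslationContinuous p) (hqp : q ≤ p) : IsTranslationContinuous q :=
  ⟨hp.1.of_le (continuous_snd.mul continuous_fst) hqp, hp.2.of_le continuous_mul hqp⟩

theorem mem_of_variation_le (hp : IsTranslationContinuous p) {μ : RegMeasure S}
    (h : (μ : ComplexMeasure S).variation ≤ p) : μ ∈ semigroupAlgebra S :=
  mem_semigroupAlgebra_iff.2 (hp.of_le h)

theorem ofMeasure_mem (hp : IsTranslationContinuous p) : ofMeasure p ∈ semigroupAlgebra S :=
  hp.mem_of_variation_le (variation_ofMeasure p).le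

end IsTranslationContinuous

variable [T2Space S] [LocallyCompactSpace S]

variable (S) in
/-- `L(S)` as a linear subspace of `M(S)`. -/
def semigroupSubmodule : Submodule ℂ (RegMeasure S) where
  carrier := semigroupAlgebra S
  zero_mem' := IsTranslationContinuous.zero.mem_of_variation_le (by simp)
  add_mem' hμ hν := ((mem_semigroupAlgebra_iff.1 hμ).add
    (mem_semigroupAlgebra_iff.1 hν)).mem_of_variation_le VectorMeasure.variation_add_le
  smul_mem' c μ hμ := by
    exact ((mem_semigroupAlgebra_iff.1 hμ).smul ‖c‖₊).mem_of_variation_le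
      VectorMeasure.variation_smul.le

theorem semigroupSubmodule_eq_span :
    semigroupSubmodule S = Submodule.span ℂ (positiveMeasures S IsTranslationContinuous) := by
  refine le_antisymm (fun μ hμ => ?_) (Submodule.span_le.2 ?_)
  · refine Submodule.span_mono ?_ (mem_span_positiveMeasures μ)
    rintro _ ⟨p, hp_fin, hp_reg, hpμ, rfl⟩
    exact ⟨p, hp_fin, hp_reg, (mem_semigroupAlgebra_iff.1 hμ).of_le hpμ, rfl⟩
  · rintro _ ⟨p, _, _, hp, rfl⟩
    exact hp.ofMeasure_mem

theorem pushforward_mulLeft_mem {μ : RegMeasure S} (hμ : μ ∈ semigroupAlgebra S) (x : S) :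
    pushforward (mulLeft x) μ ∈ semigroupAlgebra S :=
  ((mem_semigroupAlgebra_iff.1 hμ).map_mulLeft x).mem_of_variation_le
    VectorMeasure.variation_map_le

theorem continuous_pushforward_mulLeft {μ : RegMeasure S} (hμ : μ ∈ semigroupAlgebra S)
    (F : StrongDual ℂ (RegMeasure S)) : Continuous fun x => F (pushforward (mulLeft x) μ) := by
  change μ ∈ semigroupSubmodule S at hμ
  rw [semigroupSubmodule_eq_span] at hμ
  simp only [← pushforwardCLM_apply]
  induction hμ using Submodule.span_induction with
  | mem μ hμ =>
    obtain ⟨p, _, _, hp, rfl⟩ := hμ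
    simp only [pushforwardCLM_apply, pushforward_ofMeasure]
    exact hp.2.continuous_functional F
  | zero => simp [continuous_const]
  | add μ ν _ _ hμ hν => simpa only [map_add] using hμ.fun_add hν
  | smul c μ _ hμ => simpa only [map_smul] using hμ.fun_const_smul c

end Translation

/-! ### Convolution -/

section Bind

open ProbabilityTheory

theorem integral_bind {X Y E : Type*} [MeasurableSpace X] [MeasurableSpace Y]
    [NormedAddCommGroup E] [NormedSpace ℝ E] {p : Measure X} {θ : X → Measure Y}
    (hθ : Measurable θ) {f : Y → E} (hf : Integrable f (p.bind θ)) :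
    ∫ y, f y ∂p.bind θ = ∫ x, ∫ y, f y ∂θ x ∂p := by
  have h := Kernel.integral_comp (η := ⟨θ, hθ⟩) (κ := .const Unit p) (a := ()) (f := f)
  simp only [Kernel.comp_apply, Kernel.const_apply] at h
  exact h hf

theorem isFiniteMeasure_bind {X Y : Type*} [MeasurableSpace X] [MeasurableSpace Y] {p : Measure X}
    [IsFiniteMeasure p] {θ : X → Measure Y} (hθ : Measurable θ) {C : ENNReal} (hC : C ≠ ∞)
    (hθC : ∀ x, θ x Set.univ ≤ C) : IsFiniteMeasure (p.bind θ) := by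
  have : IsFiniteKernel (⟨θ, hθ⟩ : Kernel X Y) := ⟨C, hC.lt_top, hθC⟩
  exact inferInstanceAs (IsFiniteMeasure (p.bind (⟨θ, hθ⟩ : Kernel X Y)))

theorem map_bind {X Y Z : Type*} [MeasurableSpace X] [MeasurableSpace Y] [MeasurableSpace Z]
    (p : Measure X) {θ : X → Measure Y} (hθ : Measurable θ) {f : Y → Z} (hf : Measurable f) :
    (p.bind θ).map f = p.bind fun x => (θ x).map f :=
  (Measure.map_comp p ⟨θ, hθ⟩ hf).trans
    (congrArg p.bind (funext fun x => Kernel.map_apply _ hf x))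

theorem bind_map {X Y Z : Type*} [MeasurableSpace X] [MeasurableSpace Y] [MeasurableSpace Z]
    (p : Measure X) {f : X → Y} (hf : Measurable f) {θ : Y → Measure Z} (hθ : Measurable θ) :
    (p.map f).bind θ = p.bind fun x => θ (f x) := by
  rw [Measure.bind, Measure.bind, Measure.map_map hθ hf, Function.comp_def]

theorem bind_absolutelyContinuous {X Y : Type*} [MeasurableSpace X] [MeasurableSpace Y]
    {p : Measure X} {θ : X → Measure Y} (hθ : Measurable θ) {q : Measure Y}
    (h : ∀ᵐ x ∂p, θ x ≪ q) : p.bind θ ≪ q := .mk fun E hE hqE => by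
  rw [Measure.bind_apply hE hθ.aemeasurable]
  exact (lintegral_congr_ae (h.mono fun x hx => hx hqE)).trans lintegral_zero

theorem exists_dual_eq_integral {𝕜 E X : Type*} [RCLike 𝕜] [NormedAddCommGroup E]
    [NormedSpace 𝕜 E] [MeasurableSpace X] (p : Measure X) [IsFiniteMeasure p]
    {f : X → StrongDual 𝕜 E} {C : ℝ} (hf : ∀ x, ‖f x‖ ≤ C) :
    ∃ G : StrongDual 𝕜 E, ∀ v, Integrable (fun x => f x v) p → G v = ∫ x, f x v ∂p := by
  let V : Submodule 𝕜 E :=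
    { carrier := {v | Integrable (fun x => f x v) p}
      zero_mem' := by simp
      add_mem' := fun hv hw => by
        simpa only [Set.mem_ofPred_eq, map_add] using Integrable.fun_add hv hw
      smul_mem' := fun c v hv => by
        simpa only [Set.mem_ofPred_eq, map_smul] using Integrable.fun_smul c hv }
  let G₀ : StrongDual 𝕜 V := LinearMap.mkContinuous
    { toFun := fun v => ∫ x, f x v ∂p
      map_add' := fun v w => by
        simpa only [Submodule.coe_add, map_add] using MeasureTheory.integral_add v.2 w.2
      map_smul' := fun c v => by
        simpa only [Submodule.coe_smul, map_smul] using!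
          MeasureTheory.integral_smul c fun x => f x v }
    (C * p.real Set.univ) fun v => by
      refine (norm_integral_le_of_norm_le_const
        (.of_forall fun x => (f x).le_of_opNorm_le (hf x) v)).trans_eq ?_
      simp only [Submodule.coe_norm]
      ring
  obtain ⟨G, hG, -⟩ := exists_extension_norm_eq V G₀
  exact ⟨G, fun v hv => hG ⟨v, hv⟩⟩

end Bind

namespace SetwiseContinuous

variable {X : Type*} [TopologicalSpace X] [T2Space X] [MeasurableSpace X] [BorelSpace X]
  {S : Type u} [TopologicalSpace S] [T2Space S] [MeasurableSpace S] [BorelSpace S]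
  {p : Measure X} [IsFiniteMeasure p] [p.Regular]
  {θ : X → Measure S} [∀ x, IsFiniteMeasure (θ x)] [∀ x, (θ x).Regular]
  [IsFiniteMeasure (p.bind θ)]

theorem regular_bind (hθ : SetwiseContinuous θ) : (p.bind θ).Regular := by
  obtain ⟨q, _, _, hq⟩ := hθ.exists_ae_absolutelyContinuous p
  exact regular_of_absolutelyContinuous (bind_absolutelyContinuous hθ.measurable hq)

theorem functional_bind (hθ : SetwiseContinuous θ) [(p.bind θ).Regular]
    (F : StrongDual ℂ (RegMeasure S)) :
    F (ofMeasure (p.bind θ)) = ∫ x, F (ofMeasure (θ x)) ∂p := by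
  obtain ⟨q, _, _, hq⟩ := hθ.exists_ae_absolutelyContinuous p
  obtain ⟨g, hg, hF⟩ := exists_density_of_functional q F
  rw [hF _ (bind_absolutelyContinuous hθ.measurable hq),
    integral_bind hθ.measurable (hg.integrable _)]
  exact integral_congr_ae (hq.mono fun x hx => (hF _ hx).symm)

end SetwiseContinuous

section Convolution

open ContinuousMap (mulLeft mulRight)

variable {S : Type u} [Monoid S] [TopologicalSpace S] [ContinuousMul S] [MeasurableSpace S]

/-- The convolution of two positive measures, as the average of the left translates of the second
one. This makes sense without second countability, where `Measure.mconv` could fail because the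
multiplication need not be measurable for the product `σ`-algebra. -/
def conv (p q : Measure S) : Measure S := p.bind fun x => q.map (mulLeft x)

variable [BorelSpace S] {p q : Measure S}

theorem isFiniteMeasure_conv [IsFiniteMeasure p] [IsFiniteMeasure q]
    (hq : SetwiseContinuous fun x => q.map (mulLeft x)) : IsFiniteMeasure (conv p q) :=
  isFiniteMeasure_bind hq.measurable (measure_ne_top q Set.univ) fun x => by
    rw [Measure.map_apply (mulLeft x).continuous.measurable .univ, Set.preimage_univ]

theorem conv_real_apply [IsFiniteMeasure q] [IsFiniteMeasure (conv p q)]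
    (hq : SetwiseContinuous fun x => q.map (mulLeft x)) {E : Set S} (hE : MeasurableSet E) :
    (conv p q).real E = ∫ x, (q.map (mulLeft x)).real E ∂p := by
  have h := integral_bind hq.measurable
    (((integrable_const 1).indicator hE : Integrable (E.indicator (1 : S → ℝ)) (conv p q)))
  simpa only [integral_indicator_one hE] using! h

variable [IsFiniteMeasure q]

theorem conv_map_mulRight (p : Measure S) (hq : SetwiseContinuous fun x => q.map (mulLeft x))
    (y : S) : (conv p q).map (mulRight y) = conv p (q.map (mulRight y)) := by
  rw [conv, conv, map_bind p hq.measurable (mulRight y).continuous.measurable]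
  simp only [map_mulLeft_map_mulRight]

theorem conv_map_mulLeft (p : Measure S) (hq : SetwiseContinuous fun x => q.map (mulLeft x))
    (y : S) : (conv p q).map (mulLeft y) = conv (p.map (mulLeft y)) q := by
  rw [conv, conv, map_bind p hq.measurable (mulLeft y).continuous.measurable,
    bind_map p (mulLeft y).continuous.measurable hq.measurable]
  simp only [map_mulLeft_map_mulLeft]
  rfl

variable [T2Space S] [IsFiniteMeasure p]

theorem regular_conv [p.Regular] [q.Regular] (hq : SetwiseContinuous fun x => q.map (mulLeft x)) :
    (conv p q).Regular := by
  have : IsFiniteMeasure (p.bind fun x => q.map (mulLeft x)) := isFiniteMeasure_conv hq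
  exact hq.regular_bind

theorem functional_conv [p.Regular] [q.Regular] [IsFiniteMeasure (conv p q)]
    [(conv p q).Regular] (hq : SetwiseContinuous fun x => q.map (mulLeft x))
    (F : StrongDual ℂ (RegMeasure S)) :
    F (ofMeasure (conv p q)) = ∫ x, F (ofMeasure (q.map (mulLeft x))) ∂p :=
  have : IsFiniteMeasure (p.bind fun x => q.map (mulLeft x)) := ‹IsFiniteMeasure (conv p q)›
  have : (p.bind fun x => q.map (mulLeft x)).Regular := ‹(conv p q).Regular›
  hq.functional_bind F

theorem setwiseContinuous_conv_map_mulRight [q.Regular] [WeaklyLocallyCompactSpace S]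
    (hq : IsTranslationContinuous q) :
    SetwiseContinuous fun y => (conv p q).map (mulRight y) := by
  intro E hE
  let F := integralCLM (.indicator_const (1 : ℂ) hE)
  let f (x : S) : StrongDual ℂ (RegMeasure S) := F.comp (pushforwardCLM (mulLeft x))
  have hf_norm (x : S) : ‖f x‖ ≤ ‖F‖ :=
    (F.opNorm_comp_le _).trans (mul_le_of_le_one_right (norm_nonneg F) (norm_pushforwardCLM_le _))
  obtain ⟨G, hG⟩ := exists_dual_eq_integral p hf_norm
  have hG_apply (y : S) :
      G (ofMeasure (q.map (mulRight y))) = ((conv p q).map (mulRight y)).real E := by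
    have hqy : SetwiseContinuous fun x => (q.map (mulRight y)).map (mulLeft x) := by
      simp only [← map_mulLeft_map_mulRight]
      exact hq.2.map (mulRight y).continuous.measurable
    have hf_apply (x : S) : f x (ofMeasure (q.map (mulRight y))) =
        ((q.map (mulRight y)).map (mulLeft x)).real E := by
      simp only [f, F, ContinuousLinearMap.comp_apply, pushforwardCLM_apply,
        pushforward_ofMeasure, integralCLM_apply, integral_indicator _ hE, ofMeasure_apply _ hE,
        one_mul]
    have := isFiniteMeasure_conv (p := p) hqy
    rw [hG _ <| .of_bound (C := ‖F‖ * ‖ofMeasure (q.map (mulRight y))‖)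
      (by
        simpa only [hf_apply] using!
          (Complex.continuous_ofReal.comp (hqy E hE)).aestronglyMeasurable)
      (.of_forall fun x => (f x).le_of_opNorm_le (hf_norm x) _),
      conv_map_mulRight p hq.2, conv_real_apply hqy hE]
    simp only [hf_apply, integral_complex_ofReal]
  have h := hq.1.continuous_functional G
  simp only [hG_apply] at h
  exact Complex.continuous_re.comp h

theorem setwiseContinuous_conv_map_mulLeft [p.Regular] [WeaklyLocallyCompactSpace S]
    (hp : SetwiseContinuous fun x => p.map (mulLeft x))
    (hq : SetwiseContinuous fun x => q.map (mulLeft x)) :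
    SetwiseContinuous fun y => (conv p q).map (mulLeft y) := by
  intro E hE
  have hg : BoundedMeasurable fun x => ((q.map (mulLeft x)).real E : ℂ) :=
    ⟨(Complex.continuous_ofReal.comp (hq E hE)).measurable, q.real Set.univ, fun x => by
      rw [Complex.norm_real, Real.norm_of_nonneg measureReal_nonneg,
        map_measureReal_apply (mulLeft x).continuous.measurable hE]
      exact measureReal_mono (Set.subset_univ _)⟩
  have h := hp.continuous_functional (integralCLM hg)
  have hg_apply (y : S) : integralCLM hg (ofMeasure (p.map (mulLeft y))) =
      ((conv p q).map (mulLeft y)).real E := by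
    have := isFiniteMeasure_conv (p := p.map (mulLeft y)) hq
    rw [integralCLM_apply, integral_ofMeasure hg, conv_map_mulLeft p hq, conv_real_apply hq hE,
      integral_complex_ofReal]
  simp only [hg_apply] at h
  exact Complex.continuous_re.comp h

theorem IsTranslationContinuous.conv [p.Regular] [q.Regular] [WeaklyLocallyCompactSpace S]
    (hp : IsTranslationContinuous p) (hq : IsTranslationContinuous q) :
    IsTranslationContinuous (conv p q) :=
  ⟨setwiseContinuous_conv_map_mulRight hq, setwiseContinuous_conv_map_mulLeft hp.2 hq.2⟩

end Convolution

/-! ### The image of `L(S)` in the product of the algebras `B(H_π)` -/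

section Instances

variable {S : Type u} [Monoid S] [StarMul S] [TopologicalSpace S]

-- Shortcuts: searching for these through `lp` exceeds the default limits.
instance : Module ℂ (RepProduct S) := NonUnitalCStarAlgebra.toNormedSpace.toModule

instance : SMul ℂ (RepProduct S) := Module.toDistribMulAction.toSMul

instance : IsScalarTower ℂ (RepProduct S) (RepProduct S) := lp.infty_isScalarTower

instance : SMulCommClass ℂ (RepProduct S) (RepProduct S) := lp.infty_smulCommClass

instance : StarModule ℂ (RepProduct S) := inferInstance

end Instances

section Integrated

open ContinuousMap (mulLeft)

variable {S : Type u} [Monoid S] [StarMul S] [TopologicalSpace S]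

/-- The family `(π(x))_π` in the product of the algebras `B(H_π)`. -/
def translation (x : S) : RepProduct S :=
  ⟨fun π => π.op x, memℓp_infty ⟨1, by
    rintro _ ⟨π, rfl⟩
    exact π.norm_le_one x⟩⟩

theorem translation_mul (x y : S) :
    (translation (x * y) : RepProduct S) = translation x * translation y :=
  lp.ext (funext fun π => map_mul π.op x y)

theorem star_translation (x : S) :
    star (translation x : RepProduct S) = translation (star x) :=
  lp.ext (funext fun π => (π.map_star x).symm)

theorem norm_translation_le (x : S) : ‖(translation x : RepProduct S)‖ ≤ 1 :=
  lp.norm_le_of_forall_le zero_le_one fun π => π.norm_le_one x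

variable [MeasurableSpace S] [BorelSpace S]

theorem StarRep.boundedMeasurable_coeff (π : StarRep S) (ξ η : π.H) :
    BoundedMeasurable fun x => ⟪η, π.op x ξ⟫_ℂ :=
  ⟨(π.continuous_coeff ξ η).measurable, _, π.norm_coeff_le ξ η⟩

variable [T2Space S]

variable (S) in
/-- The map `μ ↦ (π̃(μ))_π`, as a bounded operator. -/
def sigmaCLM : RegMeasure S →L[ℂ] RepProduct S :=
  LinearMap.mkContinuous
    { toFun := sigmaRep
      map_add' := fun μ ν => lp.ext <| funext fun π =>
        ContinuousLinearMap.ext fun ξ => ext_inner_left ℂ fun η => by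
          change ⟪η, π.intOp (μ + ν) ξ⟫_ℂ = ⟪η, π.intOp μ ξ + π.intOp ν ξ⟫_ℂ
          simp only [inner_add_right, π.inner_intOp,
            integral_add_measure (π.boundedMeasurable_coeff ξ η)]
      map_smul' := fun c μ => lp.ext <| funext fun π =>
        ContinuousLinearMap.ext fun ξ => ext_inner_left ℂ fun η => by
          change ⟪η, π.intOp (c • μ) ξ⟫_ℂ = ⟪η, c • π.intOp μ ξ⟫_ℂ
          simp only [inner_smul_right, π.inner_intOp,
            integral_smul_measure (π.boundedMeasurable_coeff ξ η)] } 1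
    fun μ => (lp.norm_le_of_forall_le (norm_nonneg μ) fun π => π.norm_intOp_le μ).trans_eq
      (one_mul _).symm

theorem StarRep.inner_intOp_ofMeasure (π : StarRep S) (p : Measure S) [IsFiniteMeasure p]
    [p.Regular] (ξ η : π.H) :
    ⟪η, π.intOp (ofMeasure p) ξ⟫_ℂ = ∫ x, ⟪η, π.op x ξ⟫_ℂ ∂p := by
  rw [π.inner_intOp, integral_ofMeasure (π.boundedMeasurable_coeff ξ η)]

section ContinuousMul

variable [ContinuousMul S]

theorem StarRep.intOp_pushforward_mulLeft (π : StarRep S) (x : S) (μ : RegMeasure S) :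
    π.intOp (pushforward (mulLeft x) μ) = π.op x ∘L π.intOp μ := by
  refine ContinuousLinearMap.ext fun ξ => ext_inner_left ℂ fun η => ?_
  rw [π.inner_intOp, integral_pushforward _ (π.boundedMeasurable_coeff ξ η),
    ContinuousLinearMap.comp_apply, ← ContinuousLinearMap.adjoint_inner_left, π.inner_intOp]
  congr 1; ext y
  rw [ContinuousLinearMap.adjoint_inner_left, ContinuousMap.coe_mulLeft, map_mul]
  rfl

theorem translation_mul_sigmaRep (x : S) (μ : RegMeasure S) :
    translation x * sigmaRep μ = sigmaRep (pushforward (mulLeft x) μ) :=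
  lp.ext (funext fun π => (π.intOp_pushforward_mulLeft x μ).symm)

theorem sigmaRep_conv {p q : Measure S} [IsFiniteMeasure p] [p.Regular] [IsFiniteMeasure q]
    [q.Regular] (hq : SetwiseContinuous fun x => q.map (mulLeft x)) [IsFiniteMeasure (conv p q)]
    [(conv p q).Regular] :
    sigmaRep (ofMeasure (conv p q)) = sigmaRep (ofMeasure p) * sigmaRep (ofMeasure q) := by
  refine lp.ext <| funext fun π => ContinuousLinearMap.ext fun ξ => ext_inner_left ℂ fun η => ?_
  calc ⟪η, π.intOp (ofMeasure (conv p q)) ξ⟫_ℂ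
      = ∫ x, ∫ y, ⟪η, π.op y ξ⟫_ℂ ∂q.map (mulLeft x) ∂p := by
        rw [π.inner_intOp_ofMeasure]
        exact integral_bind hq.measurable ((π.boundedMeasurable_coeff ξ η).integrable (conv p q))
    _ = ∫ x, ⟪η, π.op x (π.intOp (ofMeasure q) ξ)⟫_ℂ ∂p := by
        refine integral_congr_ae (.of_forall fun x => ?_)
        beta_reduce
        rw [← π.inner_intOp_ofMeasure, ← pushforward_ofMeasure, π.intOp_pushforward_mulLeft]
        rfl
    _ = ⟪η, π.intOp (ofMeasure p) (π.intOp (ofMeasure q) ξ)⟫_ℂ :=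
        (π.inner_intOp_ofMeasure p _ η).symm

end ContinuousMul

theorem sigmaRep_map_star [ContinuousStar S] (p : Measure S) [IsFiniteMeasure p] [p.Regular] :
    sigmaRep (ofMeasure (p.map (starContinuousMap : C(S, S)))) =
      star (sigmaRep (ofMeasure p)) := by
  refine lp.ext <| funext fun π => ContinuousLinearMap.ext fun ξ => ext_inner_left ℂ fun η => ?_
  calc ⟪η, π.intOp (ofMeasure (p.map (starContinuousMap : C(S, S)))) ξ⟫_ℂ
      = ∫ x, ⟪η, π.op (star x) ξ⟫_ℂ ∂p := by
        rw [π.inner_intOp_ofMeasure]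
        exact integral_map continuous_star.aemeasurable
          (π.continuous_coeff ξ η).aestronglyMeasurable
    _ = ∫ x, conj ⟪ξ, π.op x η⟫_ℂ ∂p := by
        simp only [π.map_star, ContinuousLinearMap.adjoint_inner_right, inner_conj_symm]
    _ = conj ⟪ξ, π.intOp (ofMeasure p) η⟫_ℂ := by rw [integral_conj, π.inner_intOp_ofMeasure]
    _ = ⟪η, ContinuousLinearMap.adjoint (π.intOp (ofMeasure p)) ξ⟫_ℂ := by
        rw [inner_conj_symm, ContinuousLinearMap.adjoint_inner_right]

variable [ContinuousMul S] [LocallyCompactSpace S]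

theorem map_sigmaCLM_semigroupSubmodule :
    (semigroupSubmodule S).map (sigmaCLM S).toLinearMap =
      Submodule.span ℂ (sigmaCLM S '' positiveMeasures S IsTranslationContinuous) := by
  rw [semigroupSubmodule_eq_span, Submodule.map_span]
  rfl

theorem mul_mem_map_sigmaCLM {a b : RepProduct S}
    (ha : a ∈ (semigroupSubmodule S).map (sigmaCLM S).toLinearMap)
    (hb : b ∈ (semigroupSubmodule S).map (sigmaCLM S).toLinearMap) :
    a * b ∈ (semigroupSubmodule S).map (sigmaCLM S).toLinearMap := by
  rw [map_sigmaCLM_semigroupSubmodule] at ha hb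
  refine LinearMap.BilinMap.apply_apply_mem_of_mem_span _ _ _ (LinearMap.mul ℂ (RepProduct S))
    ?_ a b ha hb
  rintro _ ⟨_, ⟨p, _, _, hp, rfl⟩, rfl⟩ _ ⟨_, ⟨q, _, _, hq, rfl⟩, rfl⟩
  have := isFiniteMeasure_conv (p := p) hq.2
  have := regular_conv (p := p) hq.2
  exact ⟨ofMeasure (conv p q), (hp.conv hq).ofMeasure_mem, sigmaRep_conv hq.2⟩

theorem star_mem_map_sigmaCLM [ContinuousStar S] {a : RepProduct S}
    (ha : a ∈ (semigroupSubmodule S).map (sigmaCLM S).toLinearMap) :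
    star a ∈ (semigroupSubmodule S).map (sigmaCLM S).toLinearMap := by
  rw [map_sigmaCLM_semigroupSubmodule] at ha
  induction ha using Submodule.span_induction with
  | mem a ha =>
    obtain ⟨_, ⟨p, _, _, hp, rfl⟩, rfl⟩ := ha
    exact ⟨_, hp.map_star.ofMeasure_mem, sigmaRep_map_star p⟩
  | zero => exact (star_zero (RepProduct S)).symm ▸ Submodule.zero_mem _
  | add a b _ _ ha hb => exact (star_add a b).symm ▸ Submodule.add_mem _ ha hb
  | smul c a _ ha => exact (star_smul c a).symm ▸ Submodule.smul_mem _ _ ha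

variable [ContinuousStar S]

variable (S) in
/-- The image of `L(S)` in the product of the algebras `B(H_π)`, as a `*`-subalgebra. -/
def sigmaSubalgebra : NonUnitalStarSubalgebra ℂ (RepProduct S) where
  toSubmodule := (semigroupSubmodule S).map (sigmaCLM S).toLinearMap
  mul_mem' := mul_mem_map_sigmaCLM
  star_mem' := star_mem_map_sigmaCLM

theorem adjoin_sigmaRep_le :
    NonUnitalStarAlgebra.adjoin ℂ (sigmaRep '' semigroupAlgebra S) ≤ sigmaSubalgebra S := by
  rw [NonUnitalStarAlgebra.adjoin_le_iff]
  rintro _ ⟨μ, hμ, rfl⟩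
  exact ⟨μ, hμ, rfl⟩

theorem denseRange_toCStar : DenseRange (toCStar : semigroupAlgebra S → SemigroupCStar S) := by
  intro a
  have ha : a.1 ∈ closure (sigmaSubalgebra S : Set (RepProduct S)) :=
    closure_mono adjoin_sigmaRep_le a.2
  rw [Metric.mem_closure_iff] at ha ⊢
  intro ε hε
  obtain ⟨_, ⟨μ, hμ, rfl⟩, hlt⟩ := ha ε hε
  exact ⟨toCStar ⟨μ, hμ⟩, ⟨_, rfl⟩, hlt⟩

end Integrated

/-! ### The Gelfand–Naimark–Segal construction for `*`-semigroups -/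

theorem isClosed_setOf_continuous_of_norm_sub_le {X E : Type*} [TopologicalSpace X]
    [SeminormedAddCommGroup E] {F : E → X → ℂ} {C : ℝ}
    (hF : ∀ ξ ζ x, ‖F ξ x - F ζ x‖ ≤ C * ‖ξ - ζ‖) : IsClosed {ξ | Continuous (F ξ)} := by
  refine isClosed_of_closure_subset fun ξ hξ => continuous_of_uniform_approx_of_continuous
    fun U hU => ?_
  obtain ⟨ε, hε, hεU⟩ := Metric.mem_uniformity_dist.1 hU
  obtain ⟨ζ, hζ, hd⟩ := Metric.mem_closure_iff.1 hξ (ε / (|C| + 1)) (by positivity)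
  refine ⟨F ζ, hζ, fun x => hεU ?_⟩
  rw [dist_eq_norm, lt_div_iff₀ (by positivity)] at hd
  rw [dist_eq_norm]
  calc ‖F ξ x - F ζ x‖ ≤ |C| * ‖ξ - ζ‖ :=
        (hF ξ ζ x).trans (by gcongr; exact le_abs_self C)
    _ ≤ ‖ξ - ζ‖ * (|C| + 1) := by linarith [norm_nonneg (ξ - ζ)]
    _ < ε := hd

section GNS

universe v

variable {S : Type u} [Monoid S] [StarMul S] [TopologicalSpace S]

/-- Contractive weakly continuous `*`-representations on a Hilbert space. Unlike for `StarRep`, the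
space is not part of the structure and may live in any universe. -/
structure IsStarRep {H : Type v} [NormedAddCommGroup H] [InnerProductSpace ℂ H] [CompleteSpace H]
    (op : S →ₙ* (H →L[ℂ] H)) : Prop where
  map_star : ∀ x, op (star x) = ContinuousLinearMap.adjoint (op x)
  norm_le_one : ∀ x, ‖op x‖ ≤ 1
  continuous_coeff : ∀ ξ η, Continuous fun x => ⟪η, op x ξ⟫_ℂ

/-- The input of the Gelfand–Naimark–Segal construction: a weakly continuous `*`-representation by
linear maps of a semi-inner product space all of whose orbits are bounded. -/
structure IsPreStarRep {V : Type v} [AddCommGroup V] [Module ℂ V] [Inner ℂ V]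
    (T : S →ₙ* Module.End ℂ V) : Prop where
  inner_map : ∀ x v w, ⟪T x v, w⟫_ℂ = ⟪v, T (star x) w⟫_ℂ
  bounded : ∀ v, ∃ B : ℝ, ∀ x, ‖⟪T x v, T x v⟫_ℂ‖ ≤ B
  continuous_inner : ∀ v w, Continuous fun x => ⟪v, T x w⟫_ℂ

theorem IsStarRep.norm_coeff_le {H : Type v} [NormedAddCommGroup H] [InnerProductSpace ℂ H]
    [CompleteSpace H] {op : S →ₙ* (H →L[ℂ] H)} (hop : IsStarRep op) (ξ η : H) (x : S) :
    ‖⟪η, op x ξ⟫_ℂ‖ ≤ ‖η‖ * ‖ξ‖ := by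
  refine (norm_inner_le_norm _ _).trans ?_
  gcongr
  exact ((op x).le_of_opNorm_le (hop.norm_le_one x) ξ).trans_eq (one_mul _)

section Completion

open UniformSpace (Completion)

variable {V : Type v} [SeminormedAddCommGroup V] [InnerProductSpace ℂ V]
  {T : S →ₙ* Module.End ℂ V}

theorem IsPreStarRep.norm_map_le (hT : IsPreStarRep T) (x : S) (v : V) : ‖T x v‖ ≤ ‖v‖ := by
  have hsq : ∀ y, ‖T y v‖ ^ 2 = ‖⟪T y v, T y v⟫_ℂ‖ := fun y => by
    rw [inner_self_eq_norm_sq_to_K, norm_pow, RCLike.norm_ofReal, abs_norm]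
  obtain ⟨B, hB⟩ := hT.bounded v
  have hbdd : BddAbove (Set.range fun y => ‖T y v‖) :=
    ⟨√B, Set.forall_mem_range.2 fun y => Real.le_sqrt_of_sq_le ((hsq y).trans_le (hB y))⟩
  set M := ⨆ y, ‖T y v‖
  have hle : ∀ y, ‖T y v‖ ≤ M := le_ciSup hbdd
  have hM : ∀ y, ‖T y v‖ ^ 2 ≤ ‖v‖ * M := fun y => by
    rw [hsq, hT.inner_map, ← Module.End.mul_apply, ← map_mul]
    exact (norm_inner_le_norm _ _).trans (by gcongr; exact hle _)
  have hMsq : M ^ 2 ≤ ‖v‖ * M := by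
    have : Nonempty S := ⟨x⟩
    have hM0 : 0 ≤ M := (norm_nonneg _).trans (hle x)
    refine (Real.le_sqrt hM0 (by positivity)).1 ?_
    exact ciSup_le fun y => Real.le_sqrt_of_sq_le (hM y)
  refine (hle x).trans ?_
  rcases ((norm_nonneg _).trans (hle x)).eq_or_lt with h0 | h0
  · exact h0 ▸ norm_nonneg v
  · exact le_of_mul_le_mul_right (by rwa [← pow_two]) h0

/-- The extension of a bounded `*`-representation to the completed space. -/
def IsPreStarRep.completion (hT : IsPreStarRep T) :
    S →ₙ* (Completion V →L[ℂ] Completion V) where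
  toFun x := ((T x).mkContinuous 1 fun v =>
    (hT.norm_map_le x v).trans_eq (one_mul _).symm).completion
  map_mul' x y := by
    ext ξ
    induction ξ using Completion.induction_on with
    | hp => apply isClosed_eq <;> fun_prop
    | ih v => simp

theorem IsPreStarRep.completion_coe (hT : IsPreStarRep T) (x : S) (v : V) :
    hT.completion x (v : Completion V) = (T x v : V) := by
  simp [completion]

theorem IsPreStarRep.norm_completion_le (hT : IsPreStarRep T) (x : S) (ξ : Completion V) :
    ‖hT.completion x ξ‖ ≤ ‖ξ‖ := by
  induction ξ using Completion.induction_on with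
  | hp => apply isClosed_le <;> fun_prop
  | ih v => simpa only [hT.completion_coe, Completion.norm_coe] using hT.norm_map_le x v

theorem IsPreStarRep.continuous_inner_completion (hT : IsPreStarRep T) (ξ η : Completion V) :
    Continuous fun x => ⟪η, hT.completion x ξ⟫_ℂ := by
  induction ξ using Completion.induction_on with
  | hp =>
    refine isClosed_setOf_continuous_of_norm_sub_le (C := ‖η‖) fun ξ ζ x => ?_
    rw [← inner_sub_right, ← map_sub]
    exact (norm_inner_le_norm _ _).trans (by gcongr; exact hT.norm_completion_le x _)
  | ih w =>
    induction η using Completion.induction_on with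
    | hp =>
      refine isClosed_setOf_continuous_of_norm_sub_le (C := ‖w‖) fun ξ ζ x => ?_
      rw [← inner_sub_left, mul_comm, ← Completion.norm_coe w]
      exact (norm_inner_le_norm _ _).trans (by gcongr; exact hT.norm_completion_le x _)
    | ih v => simpa only [hT.completion_coe, Completion.inner_coe] using hT.continuous_inner v w

theorem IsPreStarRep.isStarRep_completion (hT : IsPreStarRep T) : IsStarRep hT.completion where
  map_star x := by
    refine (ContinuousLinearMap.eq_adjoint_iff _ _).2 fun ξ η => ?_
    induction ξ, η using Completion.induction_on₂ with
    | hp => apply isClosed_eq <;> fun_prop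
    | ih v w =>
      rw [hT.completion_coe, hT.completion_coe, Completion.inner_coe, Completion.inner_coe,
        hT.inner_map, star_star]
  norm_le_one x := ContinuousLinearMap.opNorm_le_bound _ zero_le_one fun ξ =>
    (hT.norm_completion_le x ξ).trans_eq (one_mul _).symm
  continuous_coeff := hT.continuous_inner_completion

end Completion

theorem exists_gns {V : Type v} [AddCommGroup V] [Module ℂ V] (c : PreInnerProductSpace.Core ℂ V)
    {T : S →ₙ* Module.End ℂ V} (hT : letI := c.toInner; IsPreStarRep T) :
    ∃ (H : Type v) (_ : NormedAddCommGroup H) (_ : InnerProductSpace ℂ H) (_ : CompleteSpace H)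
      (ι : V →ₗ[ℂ] H) (op : S →ₙ* (H →L[ℂ] H)), DenseRange ι ∧
      (∀ v w, ⟪ι v, ι w⟫_ℂ = c.inner v w) ∧ IsStarRep op ∧ ∀ x v, op x (ι v) = ι (T x v) := by
  let _ : SeminormedAddCommGroup V := InnerProductSpace.Core.toSeminormedAddCommGroup (c := c)
  let _ : InnerProductSpace ℂ V := InnerProductSpace.ofCore c
  have hT' : IsPreStarRep T := hT
  exact ⟨UniformSpace.Completion V, inferInstance, inferInstance, inferInstance,
    (UniformSpace.Completion.toComplL : V →L[ℂ] UniformSpace.Completion V).toLinearMap,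
    hT'.completion, UniformSpace.Completion.denseRange_coe, UniformSpace.Completion.inner_coe,
    hT'.isStarRep_completion, hT'.completion_coe⟩

end GNS

section PosDef

variable {S : Type u} [Monoid S] [StarMul S]

theorem IsPosDef.sum_nonneg {u : S → ℂ} (hu : IsPosDef u) {ι : Type*} [Fintype ι] (c : ι → ℂ)
    (x : ι → S) : 0 ≤ ∑ i, ∑ j, c i * conj (c j) * u (x i * star (x j)) := by
  have e := (Fintype.equivFin ι).symm
  have h := hu _ (c ∘ e) (x ∘ e)
  simp only [Function.comp_apply] at h
  rwa [e.sum_comp (fun i => ∑ j, c i * conj (c (e j)) * u (x i * star (x (e j)))),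
    Finset.sum_congr rfl fun i _ => e.sum_comp (fun j => c i * conj (c j) * u (x i * star (x j)))]
    at h

theorem IsPosDef.map_star {u : S → ℂ} (hu : IsPosDef u) (x : S) : u (star x) = conj (u x) := by
  have hdiag : ∀ y, (u (y * star y)).im = 0 := fun y => by
    simpa using (Complex.nonneg_iff.1 (hu 1 ![1] ![y])).2.symm
  have hone : (u 1).im = 0 := by simpa using hdiag 1
  have hsum : ∀ c : ℂ, (c * u x + conj c * u (star x)).im = 0 := fun c => by
    have h := (Complex.nonneg_iff.1 (hu 2 ![c, 1] ![x, 1])).2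
    simpa [Fin.sum_univ_two, Complex.mul_conj, hdiag, hone] using h.symm
  apply Complex.ext
  · have hI := hsum Complex.I
    simp only [Complex.conj_I, neg_mul, Complex.add_im, Complex.neg_im, Complex.I_mul_im] at hI
    rw [Complex.conj_re]
    linarith
  · have h1 := hsum 1
    simp only [map_one, one_mul, Complex.add_im] at h1
    rw [Complex.conj_im]
    linarith

/-- The semi-inner product `⟨f, g⟩ = ∑ conj (f s) g(t) u(s*t)` on finitely supported functions
which is given by a positive definite function `u`. -/
def posDefForm (u : S → ℂ) (f g : S →₀ ℂ) : ℂ :=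
  f.sum fun s a => conj a * Finsupp.linearCombination ℂ (fun t => u (star s * t)) g

theorem posDefForm_eq_sum (u : S → ℂ) (f g : S →₀ ℂ) :
    posDefForm u f g = ∑ s ∈ f.support, ∑ t ∈ g.support, conj (f s) * g t * u (star s * t) := by
  simp only [posDefForm, Finsupp.sum, Finsupp.linearCombination_apply, Finset.mul_sum, smul_eq_mul,
    mul_assoc]

theorem IsPosDef.conj_posDefForm {u : S → ℂ} (hu : IsPosDef u) (f g : S →₀ ℂ) :
    conj (posDefForm u g f) = posDefForm u f g := by
  rw [posDefForm_eq_sum, posDefForm_eq_sum, map_sum]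
  simp only [map_sum]
  rw [Finset.sum_comm]
  refine Finset.sum_congr rfl fun s _ => Finset.sum_congr rfl fun t _ => ?_
  rw [map_mul, map_mul, ← hu.map_star, star_mul, star_star, Complex.conj_conj]
  ring

theorem IsPosDef.posDefForm_self_nonneg {u : S → ℂ} (hu : IsPosDef u) (f : S →₀ ℂ) :
    0 ≤ posDefForm u f f := by
  have h := hu.sum_nonneg (fun s : f.support => conj (f s)) (fun s : f.support => star (s : S))
  simp only [Complex.conj_conj, star_star] at h
  rw [posDefForm_eq_sum, ← Finset.sum_coe_sort f.support]
  refine h.trans_eq (Finset.sum_congr rfl fun s _ => ?_)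
  exact Finset.sum_coe_sort f.support fun t => conj (f s) * f t * u (star (s : S) * t)

/-- The semi-inner product space of finitely supported functions with the form `posDefForm u`. -/
@[reducible] def IsPosDef.core {u : S → ℂ} (hu : IsPosDef u) :
    PreInnerProductSpace.Core ℂ (S →₀ ℂ) where
  inner := posDefForm u
  conj_inner_symm := hu.conj_posDefForm
  re_inner_nonneg f := (Complex.le_def.mp (hu.posDefForm_self_nonneg f)).1
  add_left f g h := by
    refine Finsupp.sum_add_index' (fun s => by rw [map_zero, zero_mul]) fun s a b => ?_
    rw [map_add, add_mul]
  smul_left f g c := by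
    change Finsupp.sum _ _ = _ * Finsupp.sum _ _
    rw [Finsupp.sum_smul_index (fun s => by rw [map_zero, zero_mul]), Finsupp.mul_sum]
    simp only [map_mul, mul_assoc]

variable (S) in
/-- The left regular representation `x δ_s = δ_{xs}` on finitely supported functions. -/
def leftRegular : S →ₙ* Module.End ℂ (S →₀ ℂ) where
  toFun x := Finsupp.lmapDomain ℂ ℂ (x * ·)
  map_mul' x y := by
    rw [Module.End.mul_eq_comp, ← Finsupp.lmapDomain_comp]
    simp only [Function.comp_def, mul_assoc]

theorem posDefForm_leftRegular_left (u : S → ℂ) (x : S) (f g : S →₀ ℂ) :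
    posDefForm u (leftRegular S x f) g = posDefForm u f (leftRegular S (star x) g) := by
  change Finsupp.sum (f.mapDomain (x * ·)) _ = Finsupp.sum _ _
  rw [Finsupp.sum_mapDomain_index (fun s => by rw [map_zero, zero_mul])
    (fun s a b => by rw [map_add, add_mul])]
  simp only [leftRegular, MulHom.coe_mk, Finsupp.lmapDomain_apply,
    Finsupp.linearCombination_mapDomain, star_mul, Function.comp_def, mul_assoc]

theorem posDefForm_leftRegular_right (u : S → ℂ) (x : S) (f g : S →₀ ℂ) :
    posDefForm u f (leftRegular S x g) =
      ∑ s ∈ f.support, conj (f s) * ∑ t ∈ g.support, g t * u (star s * (x * t)) := by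
  simp only [posDefForm, leftRegular, MulHom.coe_mk, Finsupp.lmapDomain_apply,
    Finsupp.linearCombination_mapDomain]
  simp only [Finsupp.sum, Finsupp.linearCombination_apply, Function.comp_def, smul_eq_mul]

theorem norm_posDefForm_leftRegular_le {u : S → ℂ} {C : ℝ} (hC : ∀ x, ‖u x‖ ≤ C) (x : S)
    (f g : S →₀ ℂ) : ‖posDefForm u f (leftRegular S x g)‖ ≤
      ∑ s ∈ f.support, ‖f s‖ * ∑ t ∈ g.support, ‖g t‖ * C := by
  rw [posDefForm_leftRegular_right]
  refine norm_sum_le_of_le _ fun s _ => ?_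
  rw [norm_mul, RCLike.norm_conj]
  gcongr
  refine norm_sum_le_of_le _ fun t _ => ?_
  rw [norm_mul]
  gcongr
  exact hC _

variable [TopologicalSpace S]

theorem IsPosDef.isPreStarRep_leftRegular [ContinuousMul S] {u : S → ℂ} (hu : IsPosDef u)
    (hcont : Continuous u) {C : ℝ} (hC : ∀ x, ‖u x‖ ≤ C) :
    letI := hu.core.toInner; IsPreStarRep (leftRegular S) :=
  letI := hu.core.toInner
  { inner_map := posDefForm_leftRegular_left u
    bounded := fun f => ⟨_, fun x => by
      change ‖posDefForm u _ _‖ ≤ _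
      rw [posDefForm_leftRegular_left, ← Module.End.mul_apply, ← map_mul]
      exact norm_posDefForm_leftRegular_le hC _ f f⟩
    continuous_inner := fun f g => by
      change Continuous fun x => posDefForm u f (leftRegular S x g)
      simp only [posDefForm_leftRegular_right]
      refine continuous_finsetSum _ fun s _ => continuous_const.mul
        (continuous_finsetSum _ fun t _ => continuous_const.mul (hcont.comp ?_))
      fun_prop }

theorem exists_starRep_of_mem_posDefFunctions [ContinuousMul S] {u : S → ℂ}
    (hu : u ∈ posDefFunctions S) : ∃ (π : StarRep S) (ξ : π.H), ∀ x, u x = ⟪ξ, π.op x ξ⟫_ℂ := by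
  obtain ⟨hcont, ⟨C, hC⟩, hpos⟩ := hu
  obtain ⟨H, _, _, _, ι, op, -, hι, hrep, hop⟩ :=
    exists_gns hpos.core (hpos.isPreStarRep_leftRegular hcont hC)
  refine ⟨⟨H, op, hrep.map_star, hrep.norm_le_one, hrep.continuous_coeff⟩,
    ι (Finsupp.single 1 1), fun x => ?_⟩
  change u x = ⟪ι (Finsupp.single 1 1), op x (ι (Finsupp.single 1 1))⟫_ℂ
  rw [hop, hι]
  change u x = posDefForm u _ _
  simp [posDefForm, leftRegular]

theorem IsStarRep.coeff_mem_posDefFunctions {H : Type*} [NormedAddCommGroup H]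
    [InnerProductSpace ℂ H] [CompleteSpace H] {op : S →ₙ* (H →L[ℂ] H)} (hop : IsStarRep op)
    (ξ : H) : (fun x => ⟪ξ, op x ξ⟫_ℂ) ∈ posDefFunctions S := by
  refine ⟨hop.continuous_coeff ξ ξ, ⟨‖ξ‖ * ‖ξ‖, hop.norm_coeff_le ξ ξ⟩, fun n c x => ?_⟩
  have h : ∑ i, ∑ j, c i * conj (c j) * ⟪ξ, op (x i * star (x j)) ξ⟫_ℂ =
      ⟪∑ i, conj (c i) • op (star (x i)) ξ, ∑ j, conj (c j) • op (star (x j)) ξ⟫_ℂ := by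
    rw [sum_inner]
    simp only [inner_sum, inner_smul_left, inner_smul_right, Complex.conj_conj,
      map_mul, mul_apply_eq_comp, hop.map_star, ContinuousLinearMap.adjoint_inner_left, mul_assoc]
    exact Finset.sum_congr rfl fun i _ => Finset.sum_congr rfl fun j _ => mul_left_comm _ _ _
  rw [h, inner_self_eq_norm_sq_to_K]
  positivity

end PosDef

/-! ### The pairing of `B(S)` and `C*(S)` -/

section FourierStieltjes

variable {S : Type u} [Monoid S] [StarMul S] [TopologicalSpace S]

theorem exists_boundedContinuousFunction_eq {u : S → ℂ} (hu : u ∈ fourierStieltjes S) :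
    ∃ g : BoundedContinuousFunction S ℂ, ⇑g = u := by
  induction hu using Submodule.span_induction with
  | mem u hu =>
    obtain ⟨hcont, ⟨C, hC⟩, -⟩ := hu
    exact ⟨.ofNormedAddCommGroup u hcont C hC, rfl⟩
  | zero => exact ⟨0, rfl⟩
  | add _ _ _ _ hu hv =>
    obtain ⟨⟨f, rfl⟩, ⟨g, rfl⟩⟩ := And.intro hu hv
    exact ⟨f + g, rfl⟩
  | smul c _ _ hu =>
    obtain ⟨f, rfl⟩ := hu
    exact ⟨c • f, rfl⟩

theorem continuous_of_mem_fourierStieltjes {u : S → ℂ} (hu : u ∈ fourierStieltjes S) :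
    Continuous u := by
  obtain ⟨g, rfl⟩ := exists_boundedContinuousFunction_eq hu
  exact g.continuous

theorem boundedMeasurable_of_mem_fourierStieltjes [MeasurableSpace S] [BorelSpace S] {u : S → ℂ}
    (hu : u ∈ fourierStieltjes S) : BoundedMeasurable u := by
  obtain ⟨g, rfl⟩ := exists_boundedContinuousFunction_eq hu
  exact ⟨g.continuous.measurable, ‖g‖, g.norm_coe_le_norm⟩

end FourierStieltjes

section Pairing

variable {S : Type u} [Monoid S] [StarMul S] [TopologicalSpace S] [T2Space S] [ContinuousMul S]
  [MeasurableSpace S] [BorelSpace S]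

theorem SemigroupCStar.norm_apply_le (a : SemigroupCStar S) (π : StarRep S) (ξ : π.H) :
    ‖(a.1 : RepProduct S) π ξ‖ ≤ ‖a‖ * ‖ξ‖ :=
  ((a.1 : RepProduct S) π).le_of_opNorm_le (lp.norm_apply_le_norm ENNReal.top_ne_zero a.1 π) ξ

/-- The vector functional `a ↦ ⟨a_π ξ, η⟩` on `C*(S)`. -/
def coeffDual (π : StarRep S) (η ξ : π.H) : StrongDual ℂ (SemigroupCStar S) :=
  LinearMap.mkContinuous
    { toFun := fun a => ⟪η, (a.1 : RepProduct S) π ξ⟫_ℂ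
      map_add' := fun a b => inner_add_right _ _ _
      map_smul' := fun c a => inner_smul_right _ _ _ } (‖η‖ * ‖ξ‖)
    fun a => (norm_inner_le_norm _ _).trans <|
      (mul_le_mul_of_nonneg_left (a.norm_apply_le π ξ) (norm_nonneg η)).trans_eq (by ring)

theorem coeffDual_apply (π : StarRep S) (η ξ : π.H) (a : SemigroupCStar S) :
    coeffDual π η ξ a = ⟪η, (a.1 : RepProduct S) π ξ⟫_ℂ := rfl

/-- The functional `f` on `C*(S)` is integration of `u` on the image of `L(S)`. -/
def Represents (f : StrongDual ℂ (SemigroupCStar S)) (u : S → ℂ) : Prop :=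
  ∀ μ : semigroupAlgebra S, f (toCStar μ) = integral u (μ : RegMeasure S)

theorem represents_coeffDual (π : StarRep S) (η ξ : π.H) :
    Represents (coeffDual π η ξ) fun x => ⟪η, π.op x ξ⟫_ℂ :=
  fun μ => π.inner_intOp μ ξ η

namespace Represents

theorem add {f g : StrongDual ℂ (SemigroupCStar S)} {u v : S → ℂ} (hf : Represents f u)
    (hg : Represents g v) (hu : BoundedMeasurable u) (hv : BoundedMeasurable v) :
    Represents (f + g) (u + v) := fun μ => by
  rw [_root_.add_apply, hf, hg, integral_add hu hv]

theorem smul {f : StrongDual ℂ (SemigroupCStar S)} {u : S → ℂ} (hf : Represents f u) (c : ℂ) :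
    Represents (c • f) (c • u) := fun μ => by
  rw [_root_.smul_apply, hf, smul_eq_mul, ← integral_const_mul]
  rfl

theorem zero : Represents (0 : StrongDual ℂ (SemigroupCStar S)) 0 := fun μ => by
  have h := norm_integral_le (f := (0 : S → ℂ)) (fun _ => norm_zero.le) (μ : RegMeasure S)
  rw [zero_mul, norm_le_zero_iff] at h
  exact h.symm

theorem le_norm_of_mem_pairingValues {f : StrongDual ℂ (SemigroupCStar S)} {u : S → ℂ}
    (h : Represents f u) {r : ℝ} (hr : r ∈ pairingValues u) : r ≤ ‖f‖ := by
  obtain ⟨μ, hμ, hle, rfl⟩ := hr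
  rw [← norm_toCStar ⟨μ, hμ⟩] at hle
  rw [← h ⟨μ, hμ⟩]
  exact f.unit_le_opNorm _ hle

theorem bddAbove_pairingValues {f : StrongDual ℂ (SemigroupCStar S)} {u : S → ℂ}
    (h : Represents f u) : BddAbove (pairingValues u) :=
  ⟨‖f‖, fun _ => h.le_norm_of_mem_pairingValues⟩

theorem eq_zero [LocallyCompactSpace S] (hfound : IsFoundation S) {u : S → ℂ}
    (h : Represents (0 : StrongDual ℂ (SemigroupCStar S)) u) (hcont : Continuous u)
    (hu : BoundedMeasurable u) : u = 0 := by
  have hclosed : IsClosed {x | u x = 0} := isClosed_eq hcont continuous_const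
  refine hcont.ext_on hfound continuous_const <| Set.iUnion₂_subset fun μ hμ => ?_
  have hp := mem_semigroupAlgebra_iff.1 hμ
  refine Measure.support_subset_of_isClosed hclosed <|
    (hu.integrable _).ae_eq_zero_of_forall_setIntegral_eq_zero fun E _ _ => ?_
  have hpE := hp.of_le (Measure.restrict_le_self (s := E))
  rw [← integral_ofMeasure hu]
  exact (h ⟨_, hpE.ofMeasure_mem⟩).symm

end Represents

theorem exists_represents_of_mem_fourierStieltjes {u : S → ℂ} (hu : u ∈ fourierStieltjes S) :
    ∃ f : StrongDual ℂ (SemigroupCStar S), Represents f u := by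
  induction hu using Submodule.span_induction with
  | mem u hu =>
    obtain ⟨π, ξ, hπ⟩ := exists_starRep_of_mem_posDefFunctions hu
    exact ⟨coeffDual π ξ ξ, (funext hπ : u = _) ▸ represents_coeffDual π ξ ξ⟩
  | zero => exact ⟨0, .zero⟩
  | add u v hu hv hfu hgv =>
    obtain ⟨⟨f, hf⟩, ⟨g, hg⟩⟩ := And.intro hfu hgv
    exact ⟨f + g, hf.add hg (boundedMeasurable_of_mem_fourierStieltjes hu)
      (boundedMeasurable_of_mem_fourierStieltjes hv)⟩
  | smul c u _ hfu => exact hfu.elim fun f hf => ⟨c • f, hf.smul c⟩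

variable [LocallyCompactSpace S]

variable (S) in
/-- The canonical map `L(S) → C*(S)`, as a bounded operator. -/
def toCStarCLM : ↥(semigroupSubmodule S) →L[ℂ] SemigroupCStar S :=
  LinearMap.mkContinuous
    { toFun := fun μ => toCStar ⟨μ.1, μ.2⟩
      map_add' := fun μ ν => Subtype.ext (map_add (sigmaCLM S) μ.1 ν.1)
      map_smul' := fun c μ => Subtype.ext (map_smul (sigmaCLM S) c μ.1) } 1
    fun μ => (lp.norm_le_of_forall_le (f := sigmaRep μ.1) (norm_nonneg μ) fun π =>
      π.norm_intOp_le μ.1).trans_eq (one_mul _).symm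

theorem norm_toCStarCLM (μ : semigroupSubmodule S) :
    ‖toCStarCLM S μ‖ = sigmaNorm (μ : RegMeasure S) :=
  norm_sigmaRep _

theorem Represents.norm_apply_toCStarCLM_le {f : StrongDual ℂ (SemigroupCStar S)} {u : S → ℂ}
    (h : Represents f u) (μ : semigroupSubmodule S) :
    ‖f (toCStarCLM S μ)‖ ≤ fsNorm u * ‖toCStarCLM S μ‖ := by
  rcases eq_or_ne (toCStarCLM S μ) 0 with h0 | h0
  · simp [h0]
  set ν : semigroupSubmodule S := (‖toCStarCLM S μ‖⁻¹ : ℂ) • μ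
  have hν : toCStarCLM S ν = (‖toCStarCLM S μ‖⁻¹ : ℂ) • toCStarCLM S μ := map_smul _ _ _
  have hνnorm : sigmaNorm (ν : RegMeasure S) = 1 :=
    (norm_toCStarCLM ν).symm.trans (hν ▸ norm_smul_inv_norm h0)
  have hle : ‖f (toCStarCLM S ν)‖ ≤ fsNorm u :=
    le_csSup h.bddAbove_pairingValues ⟨ν, ν.2, hνnorm.le, congrArg norm (h ⟨ν, ν.2⟩)⟩
  rwa [hν, map_smul, norm_smul, norm_inv, Complex.norm_real, norm_norm,
    inv_mul_le_iff₀ (norm_pos_iff.2 h0), mul_comm] at hle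

variable [ContinuousStar S]

theorem denseRange_toCStarCLM : DenseRange (toCStarCLM S) := denseRange_toCStar

namespace Represents

variable {f g : StrongDual ℂ (SemigroupCStar S)} {u : S → ℂ}

theorem unique (hf : Represents f u) (hg : Represents g u) : f = g :=
  DFunLike.coe_injective <| denseRange_toCStar.equalizer f.continuous g.continuous <|
    funext fun μ => (hf μ).trans (hg μ).symm

theorem norm_eq_fsNorm (h : Represents f u) : ‖f‖ = fsNorm u := by
  have h0 : 0 ≤ fsNorm u := Real.sSup_nonneg (by rintro _ ⟨μ, -, -, rfl⟩; exact norm_nonneg _)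
  refine le_antisymm (f.opNorm_le_bound h0 fun a => ?_)
    (Real.sSup_le (fun _ => h.le_norm_of_mem_pairingValues) (norm_nonneg f))
  exact denseRange_toCStarCLM.induction_on (p := fun a => ‖f a‖ ≤ fsNorm u * ‖a‖) a
    (isClosed_le (by fun_prop) (by fun_prop)) h.norm_apply_toCStarCLM_le

end Represents

end Pairing

/-! ### Decomposition of functionals into quasi-states -/

section WeakStar

open scoped Pointwise

theorem mem_of_forall_re_le {F E : Type*} [AddCommGroup F] [Module ℂ F] [Module ℝ F]
    [IsScalarTower ℝ ℂ F] [AddCommGroup E] [Module ℂ E] {B : F →ₗ[ℂ] E →ₗ[ℂ] ℂ}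
    {K : Set (WeakBilin B)} (hK : IsClosed K) (hconv : Convex ℝ K) {f : WeakBilin B}
    (h : ∀ a r, (∀ g ∈ K, (B g a).re ≤ r) → (B f a).re ≤ r) : f ∈ K := by
  by_contra hf
  obtain ⟨l, r, hlt, hgt⟩ := RCLike.geometric_hahn_banach_closed_point (𝕜 := ℂ) hconv hK hf
  obtain ⟨a, rfl⟩ := LinearMap.dualEmbedding_surjective B l
  exact (h a r fun g hg => (hlt g hg).le).not_gt hgt

variable {E : Type*} [NormedAddCommGroup E] [NormedSpace ℂ E]

/-- The set `Q - Q + i (Q - Q)`, a compact convex part of the complex span of a compact convex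
set `Q`. -/
def complexHull (Q : Set (WeakDual ℂ E)) : Set (WeakDual ℂ E) := (Q - Q) + Complex.I • (Q - Q)

variable {Q : Set (WeakDual ℂ E)}

theorem add_I_smul_mem_complexHull {p q p' q' : WeakDual ℂ E} (hp : p ∈ Q) (hq : q ∈ Q)
    (hp' : p' ∈ Q) (hq' : q' ∈ Q) : p - q + Complex.I • (p' - q') ∈ complexHull Q :=
  Set.add_mem_add (Set.sub_mem_sub hp hq) (Set.smul_mem_smul_set (Set.sub_mem_sub hp' hq'))

theorem isCompact_complexHull (hQ : IsCompact Q) : IsCompact (complexHull Q) := by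
  have hsub : IsCompact (Q - Q) := by
    simpa only [Set.sub_image_prod] using (hQ.prod hQ).image continuous_sub
  exact hsub.add (hsub.smul _)

theorem convex_complexHull (hQ : Convex ℝ Q) : Convex ℝ (complexHull Q) := by
  refine (hQ.sub hQ).add ?_
  rintro _ ⟨f, hf, rfl⟩ _ ⟨g, hg, rfl⟩ s t hs ht hst
  refine ⟨s • f + t • g, hQ.sub hQ hf hg hs ht hst, ?_⟩
  exact (smul_add _ _ _).trans <| congrArg₂ _
    (DFunLike.ext _ _ fun a => smul_comm Complex.I s (f a))
    (DFunLike.ext _ _ fun a => smul_comm Complex.I t (g a))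

theorem complexHull_subset_span : complexHull Q ⊆ Submodule.span ℂ Q := by
  have hsub : Q - Q ⊆ Submodule.span ℂ Q := by
    rintro _ ⟨p, hp, q, hq, rfl⟩
    exact sub_mem (Submodule.subset_span hp) (Submodule.subset_span hq)
  rintro _ ⟨f, hf, _, ⟨g, hg, rfl⟩, rfl⟩
  exact add_mem (hsub hf) (Submodule.smul_mem _ _ (hsub hg))

theorem span_eq_top_of_norm_le (hQ : IsCompact Q) (hconv : Convex ℝ Q)
    (h : ∀ a r, (∀ g ∈ complexHull Q, (g a).re ≤ r) → ‖a‖ ≤ r) : Submodule.span ℂ Q = ⊤ := by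
  have hball (f : StrongDual ℂ E) (hf : ‖f‖ ≤ 1) : StrongDual.toWeakDual f ∈ complexHull Q :=
    mem_of_forall_re_le (B := topDualPairing ℂ E) (isCompact_complexHull hQ).isClosed
      (convex_complexHull hconv) fun a r hr =>
        calc (f a).re ≤ ‖f a‖ := Complex.re_le_norm _
          _ ≤ ‖a‖ := (f.le_of_opNorm_le hf a).trans_eq (one_mul _)
          _ ≤ r := h a r hr
  refine Submodule.eq_top_iff'.2 fun f => ?_
  set F := WeakDual.toStrongDual f
  rcases eq_or_ne F 0 with h0 | h0
  · exact (LinearEquiv.map_eq_zero_iff _).1 h0 ▸ zero_mem _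
  · have hmem := complexHull_subset_span (hball _ (norm_smul_inv_norm (𝕜 := ℂ) h0).le)
    have hinv : (‖F‖⁻¹ : ℂ) ≠ 0 := inv_ne_zero (Complex.ofReal_ne_zero.2 (norm_ne_zero_iff.2 h0))
    exact (Submodule.smul_mem_iff _ hinv).1 hmem

end WeakStar

section QuasiStates

variable {A : Type*}

variable (A) in
/-- The positive functionals of norm at most one. Positivity, the Cauchy–Schwarz inequality
`|φ(a)|² ≤ φ(a*a)` and, on a C*-algebra, the norm bound are all contained in the displayed
inequality in `ℂ`. -/
def quasiStates [NonUnitalNormedRing A] [StarRing A] [NormedSpace ℂ A] : Set (WeakDual ℂ A) :=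
  {φ | ∀ a, φ (star a) = conj (φ a) ∧ (‖φ a‖ ^ 2 : ℂ) ≤ φ (star a * a)}

section NormedRing

variable [NonUnitalNormedRing A] [StarRing A] [NormedSpace ℂ A]

theorem zero_mem_quasiStates : (0 : WeakDual ℂ A) ∈ quasiStates A := fun a => by
  change (0 : ℂ) = conj 0 ∧ (‖(0 : ℂ)‖ ^ 2 : ℂ) ≤ 0
  simp

theorem convex_quasiStates : Convex ℝ (quasiStates A) := by
  intro φ hφ ψ hψ s t hs ht hst a
  have happ (b : A) : (s • φ + t • ψ) b = s • φ b + t • ψ b := rfl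
  simp only [happ, (hφ a).1, (hψ a).1, map_add, Complex.real_smul, map_mul, Complex.conj_ofReal,
    true_and]
  have hsq : ConvexOn ℝ Set.univ fun z : ℂ => ‖z‖ ^ 2 :=
    convexOn_univ_norm.pow (fun _ _ => norm_nonneg _) 2
  have hle := hsq.2 (Set.mem_univ (φ a)) (Set.mem_univ (ψ a)) hs ht hst
  calc ((‖s * φ a + t * ψ a‖ : ℝ) ^ 2 : ℂ)
    _ ≤ s * (‖φ a‖ ^ 2 : ℂ) + t * (‖ψ a‖ ^ 2 : ℂ) := by exact_mod_cast hle
    _ ≤ s * φ (star a * a) + t * ψ (star a * a) :=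
      add_le_add (mul_le_mul_of_nonneg_left (hφ a).2 (by exact_mod_cast hs))
        (mul_le_mul_of_nonneg_left (hψ a).2 (by exact_mod_cast ht))

theorem isClosed_quasiStates : IsClosed (quasiStates A) := by
  have heval (b : A) : Continuous fun φ : WeakDual ℂ A => φ b := WeakDual.eval_continuous b
  simp only [quasiStates, Set.ofPred_forall, Set.ofPred_and]
  refine isClosed_iInter fun a => ?_
  exact (isClosed_eq (heval _) (Complex.continuous_conj.comp (heval a))).inter
    (isClosed_le ((Complex.continuous_ofReal.comp (heval a).norm).pow 2) (heval _))

end NormedRing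

variable [NonUnitalCStarAlgebra A]

theorem norm_le_one_of_mem_quasiStates {φ : WeakDual ℂ A} (hφ : φ ∈ quasiStates A) :
    ‖WeakDual.toStrongDual φ‖ ≤ 1 := by
  set f := WeakDual.toStrongDual φ
  have hle : ‖f‖ ≤ √‖f‖ := by
    refine f.opNorm_le_bound (Real.sqrt_nonneg _) fun a => ?_
    refine le_of_sq_le_sq ?_ (by positivity)
    calc ‖φ a‖ ^ 2
      _ ≤ (φ (star a * a)).re := by exact_mod_cast (Complex.le_def.1 (hφ a).2).1
      _ ≤ ‖f (star a * a)‖ := Complex.re_le_norm _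
      _ ≤ ‖f‖ * ‖star a * a‖ := f.le_opNorm _
      _ = (√‖f‖ * ‖a‖) ^ 2 := by
        rw [CStarRing.norm_star_mul_self, mul_pow, Real.sq_sqrt (norm_nonneg f), sq ‖a‖]
  nlinarith [Real.sq_sqrt (norm_nonneg f), Real.sqrt_nonneg ‖f‖]

theorem isCompact_quasiStates : IsCompact (quasiStates A) :=
  (WeakDual.isCompact_closedBall (𝕜 := ℂ) (E := A) 0 1).of_isClosed_subset isClosed_quasiStates
    fun _ hφ => mem_closedBall_zero_iff.2 (norm_le_one_of_mem_quasiStates hφ)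

end QuasiStates

section VectorFunctionals

variable {S : Type u} [Monoid S] [StarMul S] [TopologicalSpace S]
  [T2Space S] [ContinuousMul S] [MeasurableSpace S] [BorelSpace S]

theorem coeffDual_mem_quasiStates (π : StarRep S) {ξ : π.H} (hξ : ‖ξ‖ ≤ 1) :
    StrongDual.toWeakDual (coeffDual π ξ ξ) ∈ quasiStates (SemigroupCStar S) := by
  intro a
  set T := (a.1 : RepProduct S) π
  have hnorm : ‖⟪ξ, T ξ⟫_ℂ‖ ≤ ‖T ξ‖ :=
    (norm_inner_le_norm _ _).trans (mul_le_of_le_one_left (norm_nonneg _) hξ)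
  change ⟪ξ, T.adjoint ξ⟫_ℂ = conj ⟪ξ, T ξ⟫_ℂ ∧
    (‖⟪ξ, T ξ⟫_ℂ‖ ^ 2 : ℂ) ≤ ⟪ξ, T.adjoint (T ξ)⟫_ℂ
  rw [T.adjoint_inner_right, T.adjoint_inner_right, inner_conj_symm]
  refine ⟨rfl, ?_⟩
  calc (‖⟪ξ, T ξ⟫_ℂ‖ ^ 2 : ℂ)
    _ ≤ ‖T ξ‖ ^ 2 := by exact_mod_cast pow_le_pow_left₀ (norm_nonneg _) hnorm 2
    _ = ⟪T ξ, T ξ⟫_ℂ := (inner_self_eq_norm_sq_to_K (T ξ)).symm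

theorem coeffDual_polarization (π : StarRep S) (η ξ : π.H) :
    letI q (ζ : π.H) := coeffDual π ((2 : ℂ)⁻¹ • ζ) ((2 : ℂ)⁻¹ • ζ)
    coeffDual π η ξ = q (η + ξ) - q (η - ξ) +
      Complex.I • (q (η - Complex.I • ξ) - q (η + Complex.I • ξ)) := by
  ext a
  set T := (a.1 : RepProduct S) π
  have h := inner_map_polarization' (T.adjoint : π.H →ₗ[ℂ] π.H) η ξ
  simp only [ContinuousLinearMap.coe_coe, T.adjoint_inner_left] at h
  change ⟪η, T ξ⟫_ℂ = _
  rw [h]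
  simp only [_root_.add_apply, _root_.sub_apply, _root_.smul_apply, coeffDual_apply, map_smul,
    inner_smul_left, inner_smul_right, map_inv₀, map_ofNat, smul_eq_mul]
  ring

theorem coeffDual_mem_complexHull (π : StarRep S) {η ξ : π.H} (hη : ‖η‖ ≤ 1) (hξ : ‖ξ‖ ≤ 1) :
    StrongDual.toWeakDual (coeffDual π η ξ) ∈ complexHull (quasiStates (SemigroupCStar S)) := by
  have hhalf (ζ : π.H) (hζ : ‖ζ‖ ≤ 1 + 1) :
      StrongDual.toWeakDual (coeffDual π ((2 : ℂ)⁻¹ • ζ) ((2 : ℂ)⁻¹ • ζ)) ∈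
        quasiStates (SemigroupCStar S) :=
    coeffDual_mem_quasiStates π (by rw [norm_smul]; norm_num at hζ ⊢; linarith)
  have hI : ‖Complex.I • ξ‖ ≤ 1 := by rwa [norm_smul, Complex.norm_I, one_mul]
  rw [coeffDual_polarization]
  exact add_I_smul_mem_complexHull (hhalf _ (norm_add_le_of_le hη hξ))
    (hhalf _ (norm_sub_le_of_le hη hξ)) (hhalf _ (norm_sub_le_of_le hη hI))
    (hhalf _ (norm_add_le_of_le hη hI))

theorem span_quasiStates : Submodule.span ℂ (quasiStates (SemigroupCStar S)) = ⊤ := by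
  refine span_eq_top_of_norm_le isCompact_quasiStates convex_quasiStates fun a r hr => ?_
  have hr0 : 0 ≤ r := by
    have h0 := zero_mem_quasiStates (A := SemigroupCStar S)
    have h := hr _ (add_I_smul_mem_complexHull h0 h0 h0 h0)
    rwa [sub_zero, smul_zero, add_zero] at h
  refine lp.norm_le_of_forall_le (f := (a.1 : RepProduct S)) hr0 fun π => ?_
  refine ContinuousLinearMap.opNorm_le_of_re_inner_le (𝕜 := ℂ) hr0 fun ξ η hξ hη => ?_
  rw [inner_re_symm]
  exact hr _ (coeffDual_mem_complexHull π hη.le hξ.le)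

end VectorFunctionals

/-! ### Positive functionals on `C*(S)` and positive definite functions -/

theorem exists_dual_apply_eq_integral {S : Type*} [TopologicalSpace S] [T2Space S]
    [MeasurableSpace S] [BorelSpace S] {E : Type*} [NormedAddCommGroup E] [NormedSpace ℂ E]
    {F : S → E →ₗ[ℂ] ℂ} (hF : ∀ v, Measurable fun x => F x v) {C : ℝ}
    (hC : ∀ x v, ‖F x v‖ ≤ C * ‖v‖) (μ : RegMeasure S) :
    ∃ G : StrongDual ℂ E, ∀ v, G v = integral (fun x => F x v) μ := by
  have hbm (v : E) : BoundedMeasurable fun x => F x v := ⟨hF v, _, fun x => hC x v⟩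
  refine ⟨LinearMap.mkContinuous
    { toFun := fun v => integral (fun x => F x v) μ
      map_add' := fun v w => ?_
      map_smul' := fun c v => ?_ } (C * ‖μ‖) fun v => ?_, fun _ => rfl⟩
  · simp only [map_add]
    exact integral_add (hbm v) (hbm w) μ
  · simp only [map_smul]
    exact integral_const_mul c _ μ
  · exact (norm_integral_le (fun x => hC x v) μ).trans_eq (by ring)

section Translations

variable {S : Type u} [Monoid S] [TopologicalSpace S] [ContinuousMul S]
  [MeasurableSpace S] [BorelSpace S] [T2Space S] [LocallyCompactSpace S]

theorem semigroupSubmodule_hom_ext {M : Type*} [AddCommGroup M] [Module ℂ M]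
    {f g : semigroupSubmodule S →ₗ[ℂ] M}
    (h : ∀ (p : Measure S) [IsFiniteMeasure p] [p.Regular] (hp : IsTranslationContinuous p),
      f ⟨ofMeasure p, hp.ofMeasure_mem⟩ = g ⟨ofMeasure p, hp.ofMeasure_mem⟩) : f = g := by
  have hle : semigroupSubmodule S ≤ (LinearMap.eqLocus f g).map (semigroupSubmodule S).subtype := by
    refine semigroupSubmodule_eq_span.le.trans (Submodule.span_le.2 ?_)
    rintro _ ⟨p, _, _, hp, rfl⟩
    exact ⟨⟨_, hp.ofMeasure_mem⟩, h p hp, rfl⟩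
  ext μ
  obtain ⟨ν, hν, hνμ⟩ := hle μ.2
  exact Subtype.ext hνμ ▸ hν

variable [StarMul S]

theorem exists_extension_toCStarCLM (ψ : StrongDual ℂ (SemigroupCStar S)) :
    ∃ F : StrongDual ℂ (RegMeasure S), ∀ μ : semigroupSubmodule S, F μ = ψ (toCStarCLM S μ) :=
  (exists_extension_norm_eq (semigroupSubmodule S) (ψ.comp (toCStarCLM S))).imp
    fun _ hF => hF.1

variable [ContinuousStar S]

theorem translation_mul_mem_cstarSubalgebra (x : S) {a : RepProduct S}
    (ha : a ∈ cstarSubalgebra S) : translation x * a ∈ cstarSubalgebra S := by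
  have hmaps : Set.MapsTo (translation x * ·)
      (NonUnitalStarAlgebra.adjoin ℂ (sigmaRep '' semigroupAlgebra S) : Set (RepProduct S))
      (cstarSubalgebra S) := fun b hb => by
    obtain ⟨μ, hμ, rfl⟩ := adjoin_sigmaRep_le hb
    change translation x * sigmaRep μ ∈ cstarSubalgebra S
    rw [translation_mul_sigmaRep]
    exact (toCStar ⟨_, pushforward_mulLeft_mem hμ x⟩).2
  exact hmaps.closure_left (continuous_const_mul _)
    (NonUnitalStarSubalgebra.isClosed_topologicalClosure _) ha

variable (S) in
/-- The action of `S` on `C*(S)` extending the left translation of measures. -/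
def leftTranslate : S →ₙ* Module.End ℂ (SemigroupCStar S) where
  toFun x :=
    { toFun := fun a => ⟨translation x * a.1, translation_mul_mem_cstarSubalgebra x a.2⟩
      map_add' := fun a b => Subtype.ext (mul_add (translation x) a.1 b.1)
      map_smul' := fun c a => Subtype.ext (mul_smul_comm c (translation x) a.1) }
  map_mul' x y := LinearMap.ext fun a => Subtype.ext <| by
    change translation (x * y) * a.1 = translation x * (translation y * a.1)
    rw [translation_mul, mul_assoc]

theorem star_leftTranslate_mul (x : S) (a b : SemigroupCStar S) :
    star (leftTranslate S x a) * b = star a * leftTranslate S (star x) b := by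
  refine Subtype.ext ?_
  change star (translation x * a.1) * b.1 = star a.1 * (translation (star x) * b.1)
  rw [star_mul, star_translation, mul_assoc]

theorem norm_leftTranslate_le (x : S) (a : SemigroupCStar S) : ‖leftTranslate S x a‖ ≤ ‖a‖ :=
  (norm_mul_le (translation x) a.1).trans
    (mul_le_of_le_one_left (norm_nonneg _) (norm_translation_le x))

theorem leftTranslate_toCStarCLM (x : S) (μ : semigroupSubmodule S) :
    leftTranslate S x (toCStarCLM S μ) =
      toCStarCLM S ⟨pushforward (ContinuousMap.mulLeft x) μ, pushforward_mulLeft_mem μ.2 x⟩ :=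
  Subtype.ext (translation_mul_sigmaRep x μ)

variable (ψ : StrongDual ℂ (SemigroupCStar S))

theorem norm_apply_leftTranslate_le (x : S) (a : SemigroupCStar S) :
    ‖ψ (leftTranslate S x a)‖ ≤ ‖ψ‖ * ‖a‖ :=
  (ψ.le_opNorm _).trans (by gcongr; exact norm_leftTranslate_le x a)

theorem continuous_apply_leftTranslate (a : SemigroupCStar S) :
    Continuous fun x => ψ (leftTranslate S x a) := by
  obtain ⟨F, hF⟩ := exists_extension_toCStarCLM ψ
  refine denseRange_toCStarCLM.induction_on
    (p := fun a => Continuous fun x => ψ (leftTranslate S x a)) a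
    (isClosed_setOf_continuous_of_norm_sub_le (C := ‖ψ‖) fun a b x => ?_) fun μ => ?_
  · rw [← map_sub, ← map_sub]
    exact norm_apply_leftTranslate_le ψ x (a - b)
  · simp only [leftTranslate_toCStarCLM, ← hF]
    exact continuous_pushforward_mulLeft μ.2 F

theorem boundedMeasurable_apply_leftTranslate (a : SemigroupCStar S) :
    BoundedMeasurable fun x => ψ (leftTranslate S x a) :=
  ⟨(continuous_apply_leftTranslate ψ a).measurable, _, fun x => norm_apply_leftTranslate_le ψ x a⟩

theorem integral_apply_leftTranslate_ofMeasure {p q : Measure S} [IsFiniteMeasure p] [p.Regular]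
    [IsFiniteMeasure q] [q.Regular] (hp : IsTranslationContinuous p)
    (hq : IsTranslationContinuous q) :
    integral (fun x => ψ (leftTranslate S x (toCStarCLM S ⟨ofMeasure q, hq.ofMeasure_mem⟩)))
        (ofMeasure p) =
      ψ (toCStarCLM S ⟨ofMeasure p, hp.ofMeasure_mem⟩ *
        toCStarCLM S ⟨ofMeasure q, hq.ofMeasure_mem⟩) := by
  obtain ⟨F, hF⟩ := exists_extension_toCStarCLM ψ
  have := isFiniteMeasure_conv (p := p) hq.2
  have := regular_conv (p := p) hq.2
  have hmul : toCStarCLM S ⟨ofMeasure (conv p q), (hp.conv hq).ofMeasure_mem⟩ =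
      toCStarCLM S ⟨ofMeasure p, hp.ofMeasure_mem⟩ *
        toCStarCLM S ⟨ofMeasure q, hq.ofMeasure_mem⟩ :=
    Subtype.ext (sigmaRep_conv hq.2)
  rw [integral_ofMeasure (boundedMeasurable_apply_leftTranslate ψ _), ← hmul, ← hF,
    functional_conv hq.2 F]
  simp only [leftTranslate_toCStarCLM, ← hF, pushforward_ofMeasure]

theorem integral_apply_leftTranslate (μ : semigroupSubmodule S) (a : SemigroupCStar S) :
    integral (fun x => ψ (leftTranslate S x a)) (μ : RegMeasure S) = ψ (toCStarCLM S μ * a) := by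
  have hright (p : Measure S) [IsFiniteMeasure p] [p.Regular] (hp : IsTranslationContinuous p) :
      integral (fun x => ψ (leftTranslate S x a)) (ofMeasure p) =
        ψ (toCStarCLM S ⟨ofMeasure p, hp.ofMeasure_mem⟩ * a) := by
    obtain ⟨G, hG⟩ := exists_dual_apply_eq_integral
      (F := fun x => ψ.toLinearMap ∘ₗ leftTranslate S x)
      (fun a => (continuous_apply_leftTranslate ψ a).measurable) (norm_apply_leftTranslate_le ψ)
      (ofMeasure p)
    let K := ψ ∘L ContinuousLinearMap.mul ℂ _ (toCStarCLM S ⟨ofMeasure p, hp.ofMeasure_mem⟩)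
    have hGK : (G ∘L toCStarCLM S).toLinearMap = (K ∘L toCStarCLM S).toLinearMap :=
      semigroupSubmodule_hom_ext fun q _ _ hq =>
        (hG _).trans (integral_apply_leftTranslate_ofMeasure ψ hp hq)
    exact (hG a).symm.trans <| congrFun (denseRange_toCStarCLM.equalizer G.continuous K.continuous
      (funext (LinearMap.congr_fun hGK))) a
  have hb := boundedMeasurable_apply_leftTranslate ψ a
  let K := ψ ∘L (ContinuousLinearMap.mul ℂ _).flip a
  have hleft : (integralCLM hb).toLinearMap ∘ₗ (semigroupSubmodule S).subtype =
      (K ∘L toCStarCLM S).toLinearMap :=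
    semigroupSubmodule_hom_ext hright
  exact LinearMap.congr_fun hleft μ

end Translations

theorem exists_vector_of_norm_le {V H : Type*} [AddCommGroup V] [Module ℂ V]
    [NormedAddCommGroup H] [InnerProductSpace ℂ H] [CompleteSpace H] (ι : V →ₗ[ℂ] H)
    (φ : V →ₗ[ℂ] ℂ) (h : ∀ v, ‖φ v‖ ≤ ‖ι v‖) : ∃ Ω : H, ∀ v, φ v = ⟪Ω, ι v⟫_ℂ := by
  have hφ : φ ∈ LinearMap.range ι.dualMap := by
    rw [LinearMap.range_dualMap_eq_dualAnnihilator_ker, Submodule.mem_dualAnnihilator]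
    exact fun v hv => norm_le_zero_iff.1 <| (h v).trans_eq <| by
      rw [LinearMap.mem_ker.1 hv, norm_zero]
  obtain ⟨g, rfl⟩ := hφ
  let g₀ : StrongDual ℂ (LinearMap.range ι) := (g.domRestrict _).mkContinuous 1 <| by
    rintro ⟨_, v, rfl⟩
    exact (h v).trans_eq (one_mul _).symm
  obtain ⟨G, hG, -⟩ := exists_extension_norm_eq (LinearMap.range ι) g₀
  refine ⟨(InnerProductSpace.toDual ℂ H).symm G, fun v => ?_⟩
  rw [InnerProductSpace.toDual_symm_apply]
  exact (hG ⟨ι v, v, rfl⟩).symm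

section QuasiStates

variable {A : Type*} [NonUnitalCStarAlgebra A] {φ : WeakDual ℂ A}

/-- The semi-inner product `⟪a, b⟫ = φ (a⋆ b)` of a quasi-state `φ`. -/
@[reducible] def quasiStateCore (hφ : φ ∈ quasiStates A) : PreInnerProductSpace.Core ℂ A where
  inner a b := φ (star a * b)
  conj_inner_symm a b := by rw [← (hφ _).1, star_mul, star_star]
  re_inner_nonneg a :=
    (Complex.le_def.1 ((by positivity : (0 : ℂ) ≤ ‖φ a‖ ^ 2).trans (hφ a).2)).1
  add_left a b c := by rw [star_add, add_mul, map_add]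
  smul_left a b c := by rw [star_smul, smul_mul_assoc, map_smul, smul_eq_mul]; rfl

end QuasiStates

section Surjectivity

variable {S : Type u} [Monoid S] [StarMul S] [TopologicalSpace S] [ContinuousMul S]
  [MeasurableSpace S] [BorelSpace S] [T2Space S] [LocallyCompactSpace S] [ContinuousStar S]

theorem isPreStarRep_leftTranslate {φ : WeakDual ℂ (SemigroupCStar S)}
    (hφ : φ ∈ quasiStates (SemigroupCStar S)) :
    letI := (quasiStateCore hφ).toInner; IsPreStarRep (leftTranslate S) :=
  letI := (quasiStateCore hφ).toInner
  { inner_map := fun x a b => congrArg φ (star_leftTranslate_mul x a b)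
    bounded := fun a => ⟨‖a‖ * ‖a‖, fun x => by
      change ‖WeakDual.toStrongDual φ (star (leftTranslate S x a) * leftTranslate S x a)‖ ≤ _
      refine ((WeakDual.toStrongDual φ).le_of_opNorm_le
        (norm_le_one_of_mem_quasiStates hφ) _).trans ?_
      rw [one_mul, CStarRing.norm_star_mul_self]
      gcongr <;> exact norm_leftTranslate_le x a⟩
    continuous_inner := fun a b => continuous_apply_leftTranslate
      (WeakDual.toStrongDual φ ∘L ContinuousLinearMap.mul ℂ _ (star a)) b }

theorem integral_coeff_eq_inner {H : Type*} [NormedAddCommGroup H] [InnerProductSpace ℂ H]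
    [CompleteSpace H] {op : S →ₙ* (H →L[ℂ] H)} (hop : IsStarRep op)
    {ι : SemigroupCStar S →ₗ[ℂ] H} (hι : DenseRange ι)
    (hopι : ∀ x a, op x (ι a) = ι (leftTranslate S x a)) {Ω : H}
    (hΩ : ∀ a b, ⟪ι a, ι b⟫_ℂ = ⟪Ω, ι (star a * b)⟫_ℂ)
    {ψ : StrongDual ℂ (SemigroupCStar S)} (hψ : ∀ a, ψ a = ⟪Ω, ι a⟫_ℂ)
    (μ : semigroupAlgebra S) (ζ : H) :
    integral (fun x => ⟪Ω, op x ζ⟫_ℂ) (μ : RegMeasure S) = ⟪ι (star (toCStar μ)), ζ⟫_ℂ := by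
  obtain ⟨G, hG⟩ := exists_dual_apply_eq_integral
    (F := fun x => (innerSL ℂ Ω ∘L op x).toLinearMap)
    (fun ζ => (hop.continuous_coeff ζ Ω).measurable) (fun x ζ => hop.norm_coeff_le ζ Ω x) μ
  refine (hG ζ).symm.trans ?_
  refine congrFun (hι.equalizer G.continuous (innerSL ℂ (ι (star (toCStar μ)))).continuous
    (funext fun a => ?_)) ζ
  calc G (ι a) = integral (fun x => ψ (leftTranslate S x a)) (μ : RegMeasure S) := by
        rw [hG]
        congr 1; ext x
        rw [hψ, ← hopι]
        rfl
    _ = ψ (toCStar μ * a) := integral_apply_leftTranslate ψ ⟨μ.1, μ.2⟩ a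
    _ = ⟪ι (star (toCStar μ)), ι a⟫_ℂ := by rw [hΩ, star_star, hψ]

theorem exists_represents_of_mem_quasiStates {φ : WeakDual ℂ (SemigroupCStar S)}
    (hφ : φ ∈ quasiStates (SemigroupCStar S)) :
    ∃ u ∈ posDefFunctions S, Represents (WeakDual.toStrongDual φ) u := by
  obtain ⟨H, _, _, _, ι, op, hdense, hι, hop, hopι⟩ :=
    exists_gns (quasiStateCore hφ) (isPreStarRep_leftTranslate hφ)
  have hle (a : SemigroupCStar S) : ‖φ a‖ ≤ ‖ι a‖ := by
    refine (sq_le_sq₀ (norm_nonneg _) (norm_nonneg _)).1 (Complex.real_le_real.1 ?_)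
    push_cast
    exact (hφ a).2.trans_eq ((hι a a).symm.trans (inner_self_eq_norm_sq_to_K _))
  obtain ⟨Ω, hΩ⟩ := exists_vector_of_norm_le ι (WeakDual.toStrongDual φ).toLinearMap hle
  refine ⟨_, hop.coeff_mem_posDefFunctions Ω, fun μ => ?_⟩
  rw [integral_coeff_eq_inner hop hdense hopι (fun a b => (hι a b).trans (hΩ _)) hΩ,
    ← inner_conj_symm]
  calc φ (toCStar μ) = conj (φ (star (toCStar μ))) := by rw [(hφ _).1, Complex.conj_conj]
    _ = conj ⟪Ω, ι (star (toCStar μ))⟫_ℂ := congrArg conj (hΩ _)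

theorem exists_mem_fourierStieltjes_represents (f : StrongDual ℂ (SemigroupCStar S)) :
    ∃ u ∈ fourierStieltjes S, Represents f u := by
  have hf : StrongDual.toWeakDual f ∈ Submodule.span ℂ (quasiStates (SemigroupCStar S)) :=
    span_quasiStates.ge Submodule.mem_top
  suffices ∀ φ ∈ Submodule.span ℂ (quasiStates (SemigroupCStar S)),
    ∃ u ∈ fourierStieltjes S, Represents (WeakDual.toStrongDual φ) u from this _ hf
  intro φ hφ
  induction hφ using Submodule.span_induction with
  | mem φ hφ =>
    obtain ⟨u, hu, h⟩ := exists_represents_of_mem_quasiStates hφ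
    exact ⟨u, Submodule.subset_span hu, h⟩
  | zero => exact ⟨0, Submodule.zero_mem _, .zero⟩
  | add φ ψ _ _ hφ hψ =>
    obtain ⟨⟨u, hu, hφu⟩, ⟨v, hv, hψv⟩⟩ := And.intro hφ hψ
    exact ⟨u + v, Submodule.add_mem _ hu hv, hφu.add hψv
      (boundedMeasurable_of_mem_fourierStieltjes hu) (boundedMeasurable_of_mem_fourierStieltjes hv)⟩
  | smul c φ _ hφ =>
    obtain ⟨u, hu, hφu⟩ := hφ
    exact ⟨c • u, Submodule.smul_mem _ c hu, hφu.smul c⟩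

variable (S) in
/-- The functional on `C*(S)` represented by an element of `B(S)`. -/
def toDual : fourierStieltjes S →ₗ[ℂ] StrongDual ℂ (SemigroupCStar S) where
  toFun u := (exists_represents_of_mem_fourierStieltjes u.2).choose
  map_add' u v := by
    have h (w : fourierStieltjes S) := (exists_represents_of_mem_fourierStieltjes w.2).choose_spec
    exact (h (u + v)).unique ((h u).add (h v) (boundedMeasurable_of_mem_fourierStieltjes u.2)
      (boundedMeasurable_of_mem_fourierStieltjes v.2))
  map_smul' c u := by
    have h (w : fourierStieltjes S) := (exists_represents_of_mem_fourierStieltjes w.2).choose_spec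
    exact (h (c • u)).unique ((h u).smul c)

theorem represents_toDual (u : fourierStieltjes S) : Represents (toDual S u) u :=
  (exists_represents_of_mem_fourierStieltjes u.2).choose_spec

theorem toDual_bijective (hfound : IsFoundation S) : Function.Bijective (toDual S) := by
  refine ⟨(injective_iff_map_eq_zero _).2 fun u hu => Subtype.ext ?_, fun f => ?_⟩
  · exact (hu ▸ represents_toDual u).eq_zero hfound (continuous_of_mem_fourierStieltjes u.2)
      (boundedMeasurable_of_mem_fourierStieltjes u.2)
  · obtain ⟨u, hu, h⟩ := exists_mem_fourierStieltjes_represents f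
    exact ⟨⟨u, hu⟩, (represents_toDual _).unique h⟩

end Surjectivity

end FoundationSemigroup

end

theorem theorem3p3_general {S : Type u} [Monoid S] [StarMul S] [TopologicalSpace S] [T2Space S]
    [LocallyCompactSpace S] [ContinuousMul S] [ContinuousStar S] [MeasurableSpace S] [BorelSpace S]
    (hfound : FoundationSemigroup.IsFoundation S) :
    ∃ Φ : FoundationSemigroup.fourierStieltjes S ≃ₗ[ℂ]
        StrongDual ℂ (FoundationSemigroup.SemigroupCStar S),
      (∀ (u : FoundationSemigroup.fourierStieltjes S)
          (μ : FoundationSemigroup.semigroupAlgebra S),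
        Φ u (FoundationSemigroup.toCStar μ)
          = FoundationSemigroup.integral (u : S → ℂ) (μ : FoundationSemigroup.RegMeasure S)) ∧
      ∀ u : FoundationSemigroup.fourierStieltjes S,
        BddAbove (FoundationSemigroup.pairingValues (u : S → ℂ)) ∧
        ‖Φ u‖ = FoundationSemigroup.fsNorm (u : S → ℂ) :=
  ⟨LinearEquiv.ofBijective (FoundationSemigroup.toDual S)
      (FoundationSemigroup.toDual_bijective hfound),
    FoundationSemigroup.represents_toDual, fun u =>
      ⟨(FoundationSemigroup.represents_toDual u).bddAbove_pairingValues,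
        (FoundationSemigroup.represents_toDual u).norm_eq_fsNorm⟩⟩

theorem theorem3p3 {S : Type u} [Monoid S] [StarMul S] [TopologicalSpace S] [T2Space S]
    [LocallyCompactSpace S] [ContinuousMul S] [ContinuousStar S] [MeasurableSpace S] [BorelSpace S]
    (hfound : FoundationSemigroup.IsFoundation S)
    (hsep : FoundationSemigroup.RepsSeparatePoints S) :
    ∃ Φ : FoundationSemigroup.fourierStieltjes S ≃ₗ[ℂ]
        StrongDual ℂ (FoundationSemigroup.SemigroupCStar S),
      (∀ (u : FoundationSemigroup.fourierStieltjes S)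
          (μ : FoundationSemigroup.semigroupAlgebra S),
        Φ u (FoundationSemigroup.toCStar μ)
          = FoundationSemigroup.integral (u : S → ℂ) (μ : FoundationSemigroup.RegMeasure S)) ∧
      ∀ u : FoundationSemigroup.fourierStieltjes S,
        BddAbove (FoundationSemigroup.pairingValues (u : S → ℂ)) ∧
        ‖Φ u‖ = FoundationSemigroup.fsNorm (u : S → ℂ) := by
  exact theorem3p3_general hfound
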